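/- Let $d\ge 1$ be an integer, $\mathbb T^d=\mathbb R^d/\mathbb Z^d$ with Lebesgue measure of total mass $1$, and $\widehat f(k)=\int_{\mathbb T^d} f(x)e^{-2\pi i k\cdot x}\,dx$ for $k\in\mathbb Z^d$. For $s>0$ and $t>0$ let $\Lambda^s$ and $e^{-t\Lambda^s}$ be the Fourier multiplier operators on $\mathbb T^d$ given by $$\widehat{\Lambda^s f}(k)=|k|^s\,\widehat f(k),\qquad \widehat{e^{-t\Lambda^s}f}(k)=e^{-t|k|^s}\,\widehat f(k),\qquad k\in\mathbb Z^d,$$ where $|k|$ is the Euclidean length of $k$, and let $\|\cdot\|_p$ be the norm of $L^p(\mathbb T^d)$. **Theorem 4.1 (Bernstein inequality on the torus).** Let $0<s\le 2$ and $1<p<\infty$. There is a constant $c=c_{p,s,d}>0$, depending only on $(p,s,d)$, such that for every smooth $f:\mathbb T^d\to\mathbb R$ with $\int_{\mathbb T^d} f\,dx=0$, $$\|e^{-t\Lambda^s}f\|_p\le e^{-ct}\,\|f\|_p\qquad\text{for all } t>0.$$ Consequently, there is a constant $\tilde c=\tilde c_{p,s,d}>0$, depending only on $(p,s,d)$, such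 that for every smooth $f:\mathbb T^d\to\mathbb R$ with $\int_{\mathbb T^d} f\,dx=0$, $$\int_{\mathbb T^d}(\Lambda^s f)\,|f|^{p-2}f\,dx\ \ge\ \tilde c\,\|f\|_p^p ,$$ where $|f|^{p-2}f$ is understood to be $0$ where $f=0$. -/

import Mathlib

namespace TorusBernstein

open MeasureTheory

/-- Lebesgue measure on the torus `𝕋^d = ℝ^d / ℤ^d`, of total mass `1`; it is the measure with
respect to which `UnitAddTorus.mFourierCoeff` is formed. -/
noncomputable def torusMeasure (d : ℕ) : Measure (UnitAddTorus (Fin d)) :=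
  Measure.pi fun _ => (AddCircle.haarAddCircle : Measure UnitAddCircle)

/-- A function on the torus is smooth if its periodic lift to `ℝ^d` is `C^∞`. -/
def TorusSmooth {d : ℕ} (f : UnitAddTorus (Fin d) → ℝ) : Prop :=
  ContDiff ℝ ((⊤ : ℕ∞) : WithTop ℕ∞)
    (fun x : Fin d → ℝ => f (fun i => ((x i : ℝ) : UnitAddCircle)))

/-- The Euclidean length `|k|` of a frequency `k ∈ ℤ^d`. -/
noncomputable def freqNorm {d : ℕ} (k : Fin d → ℤ) : ℝ :=
  Real.sqrt (∑ i, (k i : ℝ) ^ 2)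

/-- The Fourier series `∑ₖ m(k) f̂(k) e^{2πi k·x}`, where
`f̂(k) = ∫ f(x) e^{-2πi k·x} dx`. -/
noncomputable def multiplierSeries {d : ℕ} (m : (Fin d → ℤ) → ℝ)
    (f : UnitAddTorus (Fin d) → ℝ) (x : UnitAddTorus (Fin d)) : ℂ :=
  ∑' k : Fin d → ℤ,
    (m k : ℂ) * UnitAddTorus.mFourierCoeff (fun y => (f y : ℂ)) k * UnitAddTorus.mFourier k x

/-- The Fourier multiplier with symbol `m`, acting on real functions. The symbols used below are
even, and for those the series is real (`ofReal_fourierMultiplier`), so that nothing is lost by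
taking the real part. -/
noncomputable def fourierMultiplier {d : ℕ} (m : (Fin d → ℤ) → ℝ)
    (f : UnitAddTorus (Fin d) → ℝ) (x : UnitAddTorus (Fin d)) : ℝ :=
  (multiplierSeries m f x).re

/-- The fractional Laplacian `Λ^s = (-Δ)^{s/2}`, with symbol `|k|^s`. -/
noncomputable def fracLaplacian {d : ℕ} (s : ℝ) (f : UnitAddTorus (Fin d) → ℝ) :
    UnitAddTorus (Fin d) → ℝ :=
  fourierMultiplier (fun k => freqNorm k ^ s) f

/-- The semigroup `e^{-tΛ^s}`, with symbol `e^{-t|k|^s}`. -/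
noncomputable def fracHeat {d : ℕ} (s t : ℝ) (f : UnitAddTorus (Fin d) → ℝ) :
    UnitAddTorus (Fin d) → ℝ :=
  fourierMultiplier (fun k => Real.exp (-t * freqNorm k ^ s)) f

theorem freqNorm_neg {d : ℕ} (k : Fin d → ℤ) : freqNorm (-k) = freqNorm k := by
  simp [freqNorm]

theorem conj_mFourierCoeff {d : ℕ} (f : UnitAddTorus (Fin d) → ℝ) (k : Fin d → ℤ) :
    (starRingEnd ℂ) (UnitAddTorus.mFourierCoeff (fun y => (f y : ℂ)) k)
      = UnitAddTorus.mFourierCoeff (fun y => (f y : ℂ)) (-k) := by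
  unfold UnitAddTorus.mFourierCoeff
  rw [← integral_conj]
  refine integral_congr_ae (Filter.Eventually.of_forall fun x => ?_)
  simp [UnitAddTorus.mFourier_neg]

/-- For an even symbol and a real function the Fourier series of the multiplier is real. -/
theorem ofReal_fourierMultiplier {d : ℕ} {m : (Fin d → ℤ) → ℝ} (hm : ∀ k, m (-k) = m k)
    (f : UnitAddTorus (Fin d) → ℝ) (x : UnitAddTorus (Fin d)) :
    (fourierMultiplier m f x : ℂ) = multiplierSeries m f x := by
  rw [fourierMultiplier, ← Complex.conj_eq_iff_re]
  unfold multiplierSeries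
  rw [Complex.conj_tsum, ← (Equiv.neg (Fin d → ℤ)).tsum_eq]
  refine tsum_congr fun k => ?_
  simp only [Equiv.neg_apply, map_mul, Complex.conj_ofReal, conj_mFourierCoeff, hm, neg_neg,
    ← UnitAddTorus.mFourier_neg]

end TorusBernstein

/-! The integral inequality for `Λ^s` is the basic one, and both statements hold with the constant
`powConst (2 / p) / 2`. Decay of the norm follows from it: the time derivative of `‖v‖_p^p`, where
`v = e^{-tΛ^s} f`, is `-p ∫ (Λ^s v) |v|^{p-2} v`. Since `v` keeps mean zero, the inequality applies
at every time and Grönwall's argument gives the exponential.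

For the inequality put `h = |f|^{p-2} f` and begin with the heat semigroup `e^{-uL}`, where `L` has
symbol `|k|^2`. Its kernel `K` is nonnegative by Poisson summation and has mass one, so `∫ f h - ∫
(e^{-uL} f) h` is half the double integral of `(f(x) - f(y)) (h(x) - h(y)) K(x - y)`. With `g =
sgn(f) |f|^{p/2}`, the functions `f` and `h` are the signed powers of `g` with exponents `r = 2/p`
and `2 - r`, and `0 < r < 2` because `p > 1`. By `signedPow_comparison` the product of increments
lies between two multiples of `(g(x) - g(y))^2`. The lower bound, integrated against `K`, reduces to
the `L^2` spectral gap and yields a multiple of `(1 - e^{-u}) Var(g)`. The upper bound, integrated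
without the kernel, yields `Var(g) ≥ ½ ∫ |f|^p` because `f` has mean zero; `g` need not have. This
is `heatForm_gap`.

Finally, for `0 < σ < 1`, `λ^σ` is a positive multiple of `∫_0^∞ (1 - e^{-uλ}) u^{-1-σ} du`.
Integrating the gap over `u` with `σ = s/2` transfers it to `Λ^s` with the same constant
(`le_tsum_rpow_mul`); `s = 2` is a limit of difference quotients as `u → 0`. Smoothness enters only
through the decay of Fourier coefficients, which makes the series converge absolutely. -/

namespace TorusBernstein

open MeasureTheory Filter Topology

variable {d : ℕ}

/-! ### Signed powers and the pointwise comparison of increments -/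

/-- The odd power `x ↦ sgn(x) |x|^q`. -/
noncomputable def signedPow (q x : ℝ) : ℝ := x * |x| ^ (q - 1)

theorem signedPow_neg (q x : ℝ) : signedPow q (-x) = -signedPow q x := by
  simp [signedPow]

theorem signedPow_of_nonneg {q x : ℝ} (hq : 0 < q) (hx : 0 ≤ x) : signedPow q x = x ^ q := by
  rcases hx.eq_or_lt with rfl | hx
  · simp [signedPow, Real.zero_rpow hq.ne']
  · rw [signedPow, abs_of_pos hx, Real.rpow_sub_one hx.ne', mul_div_cancel₀ _ hx.ne']

theorem signedPow_eq_sub {q : ℝ} (hq : 0 < q) (x : ℝ) :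
    signedPow q x = max x 0 ^ q - max (-x) 0 ^ q := by
  rcases le_total 0 x with hx | hx
  · rw [signedPow_of_nonneg hq hx, max_eq_left hx, max_eq_right (by linarith),
      Real.zero_rpow hq.ne', sub_zero]
  · rw [← neg_neg x, signedPow_neg, signedPow_of_nonneg hq (by linarith : 0 ≤ -x), neg_neg,
      max_eq_right hx, max_eq_left (by linarith), Real.zero_rpow hq.ne', zero_sub]

theorem continuous_signedPow {q : ℝ} (hq : 0 < q) : Continuous (signedPow q) := by
  have h : signedPow q = fun x => max x 0 ^ q - max (-x) 0 ^ q := funext (signedPow_eq_sub hq)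
  rw [h]
  exact ((continuous_id.max continuous_const).rpow_const fun _ => Or.inr hq.le).sub
    ((continuous_neg.max continuous_const).rpow_const fun _ => Or.inr hq.le)

theorem abs_signedPow {q : ℝ} (hq : 0 < q) (x : ℝ) : |signedPow q x| = |x| ^ q := by
  rcases le_total 0 x with hx | hx
  · rw [signedPow_of_nonneg hq hx, abs_of_nonneg hx, abs_of_nonneg (Real.rpow_nonneg hx q)]
  · rw [← neg_neg x, signedPow_neg, abs_neg, abs_neg,
      signedPow_of_nonneg hq (by linarith : 0 ≤ -x), abs_of_nonneg (by linarith : 0 ≤ -x),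
      abs_of_nonneg (Real.rpow_nonneg (by linarith) q)]

theorem signedPow_signedPow {q r : ℝ} (hq : 0 < q) (hr : 0 < r) (x : ℝ) :
    signedPow q (signedPow r x) = signedPow (r * q) x := by
  have key : ∀ y : ℝ, 0 ≤ y → signedPow q (signedPow r y) = signedPow (r * q) y := fun y hy => by
    rw [signedPow_of_nonneg hr hy, signedPow_of_nonneg hq (Real.rpow_nonneg hy r),
      signedPow_of_nonneg (mul_pos hr hq) hy, Real.rpow_mul hy]
  rcases le_total 0 x with hx | hx
  · exact key x hx
  · have := key (-x) (by linarith)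
    simp only [signedPow_neg] at this
    linarith

theorem signedPow_one (x : ℝ) : signedPow 1 x = x := by simp [signedPow]

theorem mul_signedPow {q : ℝ} (hq : 0 < q) (x : ℝ) : x * signedPow q x = |x| ^ (q + 1) := by
  rcases eq_or_ne x 0 with rfl | hx
  · simp [Real.zero_rpow (by linarith : q + 1 ≠ 0)]
  · have h0 : 0 < |x| := abs_pos.mpr hx
    rw [signedPow, ← mul_assoc, ← abs_mul_abs_self x, ← pow_two, ← Real.rpow_natCast,
      ← Real.rpow_add h0]
    congr 1
    push_cast
    ring

theorem one_sub_rpow_ge {q t : ℝ} (hq : 0 < q) (ht0 : 0 ≤ t) (ht1 : t ≤ 1) :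
    min q 1 * (1 - t) ≤ 1 - t ^ q := by
  rcases le_total q 1 with h | h
  · rw [min_eq_left h]
    have := rpow_one_add_le_one_add_mul_self (by linarith : -1 ≤ t - 1) hq.le h
    rw [add_sub_cancel] at this
    linarith
  · rw [min_eq_right h, one_mul]
    have := Real.rpow_le_rpow_of_exponent_ge' ht0 ht1 zero_le_one h
    rw [Real.rpow_one] at this
    linarith

theorem min_mul_sub_le_rpow_sub {q a b : ℝ} (hq : 0 < q) (hb : 0 ≤ b) (hba : b ≤ a) (ha : 0 < a) :
    min q 1 * (1 - b / a) * a ^ q ≤ a ^ q - b ^ q := by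
  have h := one_sub_rpow_ge hq (div_nonneg hb ha.le) ((div_le_one ha).2 hba)
  have hp : 0 < a ^ q := Real.rpow_pos_of_pos ha q
  calc min q 1 * (1 - b / a) * a ^ q ≤ (1 - (b / a) ^ q) * a ^ q := by gcongr
    _ = a ^ q - b ^ q := by
      rw [Real.div_rpow hb ha.le]
      field_simp

theorem rpow_mul_rpow_two_sub {r a : ℝ} (ha : 0 ≤ a) : a ^ r * a ^ (2 - r) = a ^ 2 := by
  rw [← Real.rpow_add' ha (by simp)]
  norm_num

/-- The constant of the lower comparison between the two power differences. -/
noncomputable def powConst (r : ℝ) : ℝ := min (min r 1 * min (2 - r) 1) (1 / 2)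

theorem powConst_pos {r : ℝ} (h0 : 0 < r) (h2 : r < 2) : 0 < powConst r := by
  have : 0 < 2 - r := by linarith
  unfold powConst
  positivity

/-- Both sides are homogeneous of degree two, so for `b ≤ a` it suffices to compare each factor `1 -
(b/a)^q` with `1 - b/a`. -/
theorem powConst_mul_sq_sub_le_of_nonneg {r a b : ℝ} (h0 : 0 < r) (h2 : r < 2)
    (ha : 0 ≤ a) (hb : 0 ≤ b) :
    powConst r * (a - b) ^ 2 ≤ (a ^ r - b ^ r) * (a ^ (2 - r) - b ^ (2 - r)) := by
  wlog hba : b ≤ a generalizing a b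
  · have := this hb ha (le_of_not_ge hba)
    nlinarith
  rcases ha.eq_or_lt with rfl | ha
  · obtain rfl : b = 0 := le_antisymm hba hb
    simp
  have hr : 0 < 2 - r := by linarith
  have h1 := min_mul_sub_le_rpow_sub h0 hb hba ha
  have h3 := min_mul_sub_le_rpow_sub hr hb hba ha
  have ht : 0 ≤ 1 - b / a := by
    rw [sub_nonneg]
    exact (div_le_one ha).2 hba
  have hm1 : 0 < min r 1 := by positivity
  have hm2 : 0 < min (2 - r) 1 := by positivity
  calc powConst r * (a - b) ^ 2
      ≤ min r 1 * min (2 - r) 1 * (a - b) ^ 2 := by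
        gcongr
        exact min_le_left _ _
    _ = (min r 1 * (1 - b / a) * a ^ r) * (min (2 - r) 1 * (1 - b / a) * a ^ (2 - r)) := by
        have : (a - b) ^ 2 = (1 - b / a) ^ 2 * (a ^ r * a ^ (2 - r)) := by
          rw [rpow_mul_rpow_two_sub ha.le]
          field_simp
        rw [this]
        ring
    _ ≤ _ := mul_le_mul h1 h3 (by positivity) (h1.trans' (by positivity))

/-- After expansion, the two cross terms have product `(ab)^2`, so by AM-GM their sum is at least
`2ab`. -/
theorem rpow_sub_mul_rpow_sub_le {r a b : ℝ} (ha : 0 ≤ a) (hb : 0 ≤ b) :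
    (a ^ r - b ^ r) * (a ^ (2 - r) - b ^ (2 - r)) ≤ (a - b) ^ 2 := by
  have hA := rpow_mul_rpow_two_sub (r := r) ha
  have hB := rpow_mul_rpow_two_sub (r := r) hb
  have hp1 : 0 ≤ a ^ r * b ^ (2 - r) := by positivity
  have hp2 : 0 ≤ b ^ r * a ^ (2 - r) := by positivity
  have hprod : (a ^ r * b ^ (2 - r)) * (b ^ r * a ^ (2 - r)) = (a * b) ^ 2 := by
    calc _ = (a ^ r * a ^ (2 - r)) * (b ^ r * b ^ (2 - r)) := by ring
      _ = _ := by rw [hA, hB]; ring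
  have hamgm : 2 * (a * b) ≤ a ^ r * b ^ (2 - r) + b ^ r * a ^ (2 - r) := by
    refine abs_le_of_sq_le_sq' ?_ (by positivity) |>.2
    nlinarith [sq_nonneg (a ^ r * b ^ (2 - r) - b ^ r * a ^ (2 - r))]
  nlinarith

/-- The case of arguments of opposite sign, where increments become sums. The lower bound drops the
cross terms and uses `(x + y)^2 / 2 ≤ x^2 + y^2`, whence the cap `1/2` in `powConst`. The upper
bound uses that the cross terms sum to at most `x^2 + y^2`, since the same-sign product of
differences is nonnegative. -/
theorem signedPow_comparison_aux {r x y : ℝ} (h0 : 0 < r) (h2 : r < 2) (hx : 0 ≤ x) (hy : 0 ≤ y) :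
    powConst r * (x + y) ^ 2 ≤ (x ^ r + y ^ r) * (x ^ (2 - r) + y ^ (2 - r)) ∧
      (x ^ r + y ^ r) * (x ^ (2 - r) + y ^ (2 - r)) ≤ 2 * (x + y) ^ 2 := by
  have hA := rpow_mul_rpow_two_sub (r := r) hx
  have hB := rpow_mul_rpow_two_sub (r := r) hy
  have hp1 : 0 ≤ x ^ r * y ^ (2 - r) := by positivity
  have hp2 : 0 ≤ y ^ r * x ^ (2 - r) := by positivity
  have hc : powConst r ≤ 1 / 2 := min_le_right _ _
  have hc0 := powConst_pos h0 h2
  have hm := (powConst_mul_sq_sub_le_of_nonneg h0 h2 hx hy).trans' (by positivity)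
  have hxy : 0 ≤ x * y := by positivity
  constructor
  · have : powConst r * (x + y) ^ 2 ≤ 1 / 2 * (x + y) ^ 2 := by gcongr
    nlinarith [sq_nonneg (x - y)]
  · nlinarith

theorem signedPow_comparison {r : ℝ} (h0 : 0 < r) (h2 : r < 2) (a b : ℝ) :
    powConst r * (a - b) ^ 2
        ≤ (signedPow r a - signedPow r b) * (signedPow (2 - r) a - signedPow (2 - r) b) ∧
      (signedPow r a - signedPow r b) * (signedPow (2 - r) a - signedPow (2 - r) b)
        ≤ 2 * (a - b) ^ 2 := by
  have hr : 0 < 2 - r := by linarith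
  have pos : ∀ x y : ℝ, 0 ≤ x → 0 ≤ y →
      powConst r * (x - y) ^ 2 ≤ (x ^ r - y ^ r) * (x ^ (2 - r) - y ^ (2 - r)) ∧
      (x ^ r - y ^ r) * (x ^ (2 - r) - y ^ (2 - r)) ≤ 2 * (x - y) ^ 2 := fun x y hx hy =>
    ⟨powConst_mul_sq_sub_le_of_nonneg h0 h2 hx hy,
      (rpow_sub_mul_rpow_sub_le hx hy).trans (by nlinarith [sq_nonneg (x - y)])⟩
  have ev : ∀ q : ℝ, 0 < q → ∀ x : ℝ, x ≤ 0 → signedPow q x = -(-x) ^ q := fun q hq x hx => by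
    rw [← signedPow_of_nonneg hq (neg_nonneg.2 hx), signedPow_neg, neg_neg]
  rcases le_total 0 a with ha | ha <;> rcases le_total 0 b with hb | hb
  · simpa only [signedPow_of_nonneg h0, signedPow_of_nonneg hr, ha, hb] using pos a b ha hb
  · rw [signedPow_of_nonneg h0 ha, signedPow_of_nonneg hr ha, ev _ h0 b hb, ev _ hr b hb]
    have := signedPow_comparison_aux h0 h2 ha (neg_nonneg.2 hb)
    constructor <;> linarith [this.1, this.2]
  · rw [signedPow_of_nonneg h0 hb, signedPow_of_nonneg hr hb, ev _ h0 a ha, ev _ hr a ha]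
    have := signedPow_comparison_aux h0 h2 hb (neg_nonneg.2 ha)
    constructor <;> linarith [this.1, this.2]
  · rw [ev _ h0 b hb, ev _ hr b hb, ev _ h0 a ha, ev _ hr a ha]
    have := pos (-a) (-b) (neg_nonneg.2 ha) (neg_nonneg.2 hb)
    constructor <;> linarith [this.1, this.2]

/-! ### Lattice sums and positivity of the theta function -/

theorem summable_pi_prod {ι κ : Type*} [Fintype ι] {g : ι → κ → ℝ}
    (h0 : ∀ i n, 0 ≤ g i n) (hg : ∀ i, Summable (g i)) :
    Summable fun k : ι → κ => ∏ i, g i (k i) := by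
  classical
  refine summable_of_sum_le (c := ∏ i, ∑' n, g i n)
    (fun k => Finset.prod_nonneg fun i _ => h0 i _) fun s => ?_
  have hs : s ⊆ Fintype.piFinset fun i => s.image fun k => k i := fun k hk =>
    Fintype.mem_piFinset.2 fun i => Finset.mem_image_of_mem _ hk
  refine (Finset.sum_le_sum_of_subset_of_nonneg hs
    fun k _ _ => Finset.prod_nonneg fun i _ => h0 i _).trans ?_
  rw [← Finset.prod_univ_sum]
  exact Finset.prod_le_prod (fun i _ => Finset.sum_nonneg fun n _ => h0 i n)
    fun i _ => (hg i).sum_le_tsum _ fun n _ => h0 i n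

/-- Absolute summability allows the sum to be computed along the boxes `[-N, N]^ι`, where the finite
sum factorises. -/
theorem hasSum_pi_prod {ι : Type*} [Fintype ι] {g : ι → ℤ → ℂ}
    (hg : ∀ i, Summable fun n => ‖g i n‖) :
    HasSum (fun k : ι → ℤ => ∏ i, g i (k i)) (∏ i, ∑' n, g i n) := by
  classical
  have hs : Summable fun k : ι → ℤ => ∏ i, g i (k i) := by
    refine Summable.of_norm ?_
    simp only [norm_prod]
    exact summable_pi_prod (g := fun i n => ‖g i n‖) (fun i n => norm_nonneg _) hg
  let box : ℕ → Finset (ι → ℤ) := fun N => Fintype.piFinset fun _ => Finset.Icc (-(N : ℤ)) N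
  have hint : Tendsto (fun N : ℕ => Finset.Icc (-(N : ℤ)) N) atTop atTop := by
    refine tendsto_atTop_finset_of_monotone (fun M N h => ?_) fun n => ⟨n.natAbs, ?_⟩
    · exact Finset.Icc_subset_Icc (by omega) (by omega)
    · simp only [Finset.mem_Icc]
      omega
  have hbox : Tendsto box atTop atTop := by
    refine tendsto_atTop_finset_of_monotone (fun M N h => ?_) fun k =>
      ⟨∑ i, (k i).natAbs, ?_⟩
    · exact Fintype.piFinset_subset _ _ fun _ => Finset.Icc_subset_Icc (by omega) (by omega)
    · refine Fintype.mem_piFinset.2 fun i => ?_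
      have : (k i).natAbs ≤ ∑ i, (k i).natAbs :=
        Finset.single_le_sum (f := fun i => (k i).natAbs) (fun _ _ => Nat.zero_le _)
          (Finset.mem_univ i)
      rw [Finset.mem_Icc]
      omega
  have h1 := hs.hasSum.comp hbox
  have h2 : Tendsto (fun N : ℕ => ∏ i, ∑ n ∈ Finset.Icc (-(N : ℤ)) N, g i n) atTop
      (𝓝 (∏ i, ∑' n, g i n)) :=
    tendsto_finsetProd _ fun i _ => Tendsto.comp (g := fun s => ∑ n ∈ s, g i n)
      (hg i).of_norm.hasSum hint
  have h3 : (fun s : Finset (ι → ℤ) => ∑ k ∈ s, ∏ i, g i (k i)) ∘ box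
      = fun N : ℕ => ∏ i, ∑ n ∈ Finset.Icc (-(N : ℤ)) N, g i n := by
    funext N
    simp only [Function.comp_apply, box]
    rw [← Finset.prod_univ_sum]
  change Tendsto ((fun s : Finset (ι → ℤ) => ∑ k ∈ s, ∏ i, g i (k i)) ∘ box) atTop _ at h1
  rw [h3] at h1
  rw [← tendsto_nhds_unique h1 h2]
  exact hs.hasSum

theorem summable_one_div_one_add_sq : Summable fun n : ℤ => 1 / (1 + (n : ℝ) ^ 2) := by
  refine Summable.of_nonneg_of_le (fun n => by positivity) (fun n => ?_)
    -- The comparison series has the value `1 / 0 = 0` at `n = 0`; the indicator of `0` supplies the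
    -- missing term.
    ((Real.summable_one_div_int_pow (p := 2)).2 (by norm_num) |>.add
      (summable_of_ne_finset_zero (s := {0}) (f := fun n : ℤ => if n = 0 then (1 : ℝ) else 0)
        (by simp +contextual)))
  rcases eq_or_ne n 0 with rfl | hn
  · simp
  · have : (0 : ℝ) < (n : ℝ) ^ 2 := by positivity
    simp only [hn, if_false, add_zero]
    gcongr
    linarith

theorem summable_exp_neg_mul_int_sq {u : ℝ} (hu : 0 < u) :
    Summable fun n : ℤ => Real.exp (-u * (n : ℝ) ^ 2) := by
  refine Summable.of_nonneg_of_le (fun n => by positivity) (fun n => ?_)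
    (summable_one_div_one_add_sq.mul_left (max 1 (1 / u)))
  have h1 : 1 + u * (n : ℝ) ^ 2 ≤ Real.exp (u * (n : ℝ) ^ 2) := by
    linarith [Real.add_one_le_exp (u * (n : ℝ) ^ 2)]
  -- The factor `M = max 1 (1/u)` satisfies `M ≥ 1` and `M u ≥ 1`, so `1 + n^2 ≤ M (1 + u n^2) ≤ M
  -- e^{u n^2}`.
  have hM1 : 1 ≤ max 1 (1 / u) := le_max_left _ _
  have hM2 : 1 ≤ max 1 (1 / u) * u := by
    have := mul_le_mul_of_nonneg_right (le_max_right 1 (1 / u)) hu.le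
    rwa [one_div_mul_cancel hu.ne'] at this
  rw [neg_mul, Real.exp_neg, mul_one_div, le_div_iff₀ (by positivity),
    inv_mul_le_iff₀ (Real.exp_pos _)]
  have hn : (0 : ℝ) ≤ (n : ℝ) ^ 2 := by positivity
  calc 1 + (n : ℝ) ^ 2 ≤ max 1 (1 / u) + max 1 (1 / u) * u * (n : ℝ) ^ 2 := by
        gcongr
        nlinarith
    _ = (1 + u * (n : ℝ) ^ 2) * max 1 (1 / u) := by ring
    _ ≤ _ := by gcongr

/-- Jacobi's identity (Poisson summation) turns the series into a positive multiple of a sum of real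
Gaussians centred at the integer translates of `x`. -/
theorem exists_theta_eq_ofReal {u : ℝ} (hu : 0 < u) (x : UnitAddCircle) :
    ∃ r : ℝ, 0 ≤ r ∧
      ∑' n : ℤ, (Real.exp (-u * (n : ℝ) ^ 2) : ℂ) * fourier n x = (r : ℂ) := by
  induction x using QuotientAddGroup.induction_on with
  | H x =>
  have ha : 0 < ((u / Real.pi : ℝ) : ℂ).re := by
    rw [Complex.ofReal_re]
    positivity
  have key := Complex.tsum_exp_neg_quadratic ha (Complex.I * x)
  refine ⟨1 / (u / Real.pi) ^ (1 / 2 : ℝ) *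
    ∑' n : ℤ, Real.exp (-Real.pi / (u / Real.pi) * ((n : ℝ) - x) ^ 2), ?_, ?_⟩
  · have : 0 ≤ ∑' n : ℤ, Real.exp (-Real.pi / (u / Real.pi) * ((n : ℝ) - x) ^ 2) :=
      tsum_nonneg fun n => (Real.exp_pos _).le
    positivity
  · calc _ = ∑' n : ℤ, Complex.exp (-Real.pi * ((u / Real.pi : ℝ) : ℂ) * (n : ℂ) ^ 2
            + 2 * Real.pi * (Complex.I * x) * n) := by
          refine tsum_congr fun n => ?_
          rw [fourier_coe_apply, Complex.exp_add, Complex.ofReal_exp]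
          have hpi : (Real.pi : ℂ) ≠ 0 := by exact_mod_cast Real.pi_ne_zero
          congr 2
          · push_cast
            field_simp
          · push_cast
            ring
      _ = _ := by
          rw [key]
          push_cast
          congr 1
          · rw [Complex.ofReal_cpow (by positivity)]
            push_cast
            rfl
          · refine tsum_congr fun n => ?_
            congr 2
            rw [← mul_assoc, Complex.I_mul_I]
            ring

/-! ### The heat kernel on the torus -/

theorem freqNorm_sq (k : Fin d → ℤ) : freqNorm k ^ 2 = ∑ i, (k i : ℝ) ^ 2 :=
  Real.sq_sqrt (Finset.sum_nonneg fun _ _ => sq_nonneg _)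

theorem freqNorm_nonneg (k : Fin d → ℤ) : 0 ≤ freqNorm k := Real.sqrt_nonneg _

theorem freqNorm_zero : freqNorm (0 : Fin d → ℤ) = 0 := by simp [freqNorm]

theorem one_le_freqNorm_sq {k : Fin d → ℤ} (hk : k ≠ 0) : 1 ≤ freqNorm k ^ 2 := by
  obtain ⟨i, hi⟩ := Function.ne_iff.1 hk
  rw [freqNorm_sq]
  refine le_trans ?_ (Finset.single_le_sum (f := fun i => (k i : ℝ) ^ 2)
    (fun _ _ => sq_nonneg _) (Finset.mem_univ i))
  have : 1 ≤ (k i) ^ 2 := Int.one_le_abs (pow_ne_zero 2 hi) |>.trans_eq (abs_of_nonneg (sq_nonneg _))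
  exact_mod_cast this

theorem exp_neg_freqNorm_sq (u : ℝ) (k : Fin d → ℤ) :
    Real.exp (-u * freqNorm k ^ 2) = ∏ i, Real.exp (-u * (k i : ℝ) ^ 2) := by
  rw [freqNorm_sq, Finset.mul_sum, Real.exp_sum]

theorem summable_exp_neg_freqNorm_sq {u : ℝ} (hu : 0 < u) :
    Summable fun k : Fin d → ℤ => Real.exp (-u * freqNorm k ^ 2) := by
  simp only [exp_neg_freqNorm_sq]
  exact summable_pi_prod (g := fun _ (n : ℤ) => Real.exp (-u * (n : ℝ) ^ 2))
    (fun (_ : Fin d) _ => (Real.exp_pos _).le) fun _ => summable_exp_neg_mul_int_sq hu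

theorem norm_mFourier_apply (k : Fin d → ℤ) (x : UnitAddTorus (Fin d)) :
    ‖UnitAddTorus.mFourier k x‖ = 1 := by
  simp only [UnitAddTorus.mFourier, ContinuousMap.coe_mk, norm_prod, fourier_apply,
    Circle.norm_coe, Finset.prod_const_one]

theorem exists_heatSeries_eq_ofReal {u : ℝ} (hu : 0 < u) (x : UnitAddTorus (Fin d)) :
    ∃ r : ℝ, 0 ≤ r ∧ ∑' k : Fin d → ℤ,
      (Real.exp (-u * freqNorm k ^ 2) : ℂ) * UnitAddTorus.mFourier k x = (r : ℂ) := by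
  choose r hr0 hr using fun i => exists_theta_eq_ofReal hu (x i)
  refine ⟨∏ i, r i, Finset.prod_nonneg fun i _ => hr0 i, ?_⟩
  have h := hasSum_pi_prod (g := fun i n => (Real.exp (-u * (n : ℝ) ^ 2) : ℂ) * fourier n (x i))
    fun i => by
      simpa only [norm_mul, fourier_apply, Circle.norm_coe, mul_one, Complex.norm_real,
        Real.norm_eq_abs, Real.abs_exp] using summable_exp_neg_mul_int_sq hu
  simp only [hr] at h
  rw [Complex.ofReal_prod, ← h.tsum_eq]
  refine tsum_congr fun k => ?_
  rw [Finset.prod_mul_distrib, exp_neg_freqNorm_sq, Complex.ofReal_prod]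
  rfl

/-- The heat kernel of the torus, as the real part of its Fourier series. -/
noncomputable def heatKernel (u : ℝ) (x : UnitAddTorus (Fin d)) : ℝ :=
  (∑' k : Fin d → ℤ, (Real.exp (-u * freqNorm k ^ 2) : ℂ) * UnitAddTorus.mFourier k x).re

theorem heatKernel_nonneg {u : ℝ} (hu : 0 < u) (x : UnitAddTorus (Fin d)) :
    0 ≤ heatKernel u x := by
  obtain ⟨r, hr, h⟩ := exists_heatSeries_eq_ofReal hu x
  rw [heatKernel, h]
  simpa using hr

theorem ofReal_heatKernel {u : ℝ} (hu : 0 < u) (x : UnitAddTorus (Fin d)) :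
    (heatKernel u x : ℂ) =
      ∑' k : Fin d → ℤ, (Real.exp (-u * freqNorm k ^ 2) : ℂ) * UnitAddTorus.mFourier k x := by
  obtain ⟨r, hr, h⟩ := exists_heatSeries_eq_ofReal hu x
  rw [heatKernel, h, Complex.ofReal_re]

theorem continuous_heatKernel {u : ℝ} (hu : 0 < u) :
    Continuous (heatKernel u : UnitAddTorus (Fin d) → ℝ) := by
  refine Complex.continuous_re.comp (continuous_tsum (fun k => by fun_prop)
    (summable_exp_neg_freqNorm_sq hu) fun k x => ?_)
  rw [norm_mul, norm_mFourier_apply, mul_one, Complex.norm_real, Real.norm_eq_abs, Real.abs_exp]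

/-! ### Fourier coefficients and the Parseval pairing -/

instance : IsProbabilityMeasure (torusMeasure d) := by
  unfold torusMeasure
  infer_instance

instance : Measure.IsAddHaarMeasure (torusMeasure d) := by
  unfold torusMeasure
  infer_instance

/-- The Fourier coefficient of a real function. -/
noncomputable abbrev coeff (f : UnitAddTorus (Fin d) → ℝ) (k : Fin d → ℤ) : ℂ :=
  UnitAddTorus.mFourierCoeff (fun y => (f y : ℂ)) k

theorem coeff_eq_integral (f : UnitAddTorus (Fin d) → ℝ) (k : Fin d → ℤ) :
    coeff f k = ∫ x, UnitAddTorus.mFourier (-k) x * (f x : ℂ) ∂torusMeasure d := rfl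

theorem coeff_zero (f : UnitAddTorus (Fin d) → ℝ) :
    coeff f 0 = ((∫ x, f x ∂torusMeasure d : ℝ) : ℂ) := by
  rw [coeff_eq_integral, ← integral_complex_ofReal]
  simp [UnitAddTorus.mFourier_zero]

theorem coeff_neg (f : UnitAddTorus (Fin d) → ℝ) (k : Fin d → ℤ) :
    coeff f (-k) = (starRingEnd ℂ) (coeff f k) := (conj_mFourierCoeff f k).symm

theorem norm_coeff_le (f : UnitAddTorus (Fin d) → ℝ) (k : Fin d → ℤ) :
    ‖coeff f k‖ ≤ ∫ x, |f x| ∂torusMeasure d := by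
  rw [coeff_eq_integral]
  refine (norm_integral_le_integral_norm _).trans_eq ?_
  simp [norm_mFourier_apply]

theorem integrable_torus {E : Type*} [NormedAddCommGroup E] {f : UnitAddTorus (Fin d) → E}
    (hf : Continuous f) : Integrable f (torusMeasure d) :=
  hf.integrable_of_hasCompactSupport (HasCompactSupport.of_compactSpace f)

theorem integrable_torus_prod {E : Type*} [NormedAddCommGroup E]
    {f : UnitAddTorus (Fin d) × UnitAddTorus (Fin d) → E}
    (hf : Continuous f) : Integrable f ((torusMeasure d).prod (torusMeasure d)) :=
  hf.integrable_of_hasCompactSupport (HasCompactSupport.of_compactSpace f)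

theorem hasSum_sq_coeff {f : UnitAddTorus (Fin d) → ℝ} (hf : Continuous f) :
    HasSum (fun k => ‖coeff f k‖ ^ 2) (∫ x, f x ^ 2 ∂torusMeasure d) := by
  let F : C(UnitAddTorus (Fin d), ℂ) := ⟨fun x => (f x : ℂ), by fun_prop⟩
  have h := UnitAddTorus.hasSum_sq_mFourierCoeff
    (ContinuousMap.toLp (E := ℂ) 2 (torusMeasure d) ℂ F)
  have h1 : ∀ k, UnitAddTorus.mFourierCoeff (ContinuousMap.toLp (E := ℂ) 2 (torusMeasure d) ℂ F) k
      = coeff f k := fun k => UnitAddTorus.mFourierCoeff_toLp F k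
  have h2 : ∫ x, f x ^ 2 ∂torusMeasure d
      = ∫ x, ‖(ContinuousMap.toLp (E := ℂ) 2 (torusMeasure d) ℂ F) x‖ ^ 2 ∂torusMeasure d := by
    refine integral_congr_ae ?_
    filter_upwards [ContinuousMap.coeFn_toLp (p := 2) (𝕜 := ℂ) (torusMeasure d) F] with x hx
    rw [hx]
    simp [F]
  simp only [← h1, h2]
  exact h

/-- The summands of the Parseval formula for `∫ f g`. -/
noncomputable def pairCoeff (f g : UnitAddTorus (Fin d) → ℝ) (k : Fin d → ℤ) : ℝ :=
  (coeff f k * coeff g (-k)).re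

theorem pairCoeff_neg (f g : UnitAddTorus (Fin d) → ℝ) (k : Fin d → ℤ) :
    pairCoeff f g (-k) = pairCoeff f g k := by
  unfold pairCoeff
  rw [neg_neg, coeff_neg, coeff_neg, ← Complex.conj_re, map_mul, Complex.conj_conj]

theorem pairCoeff_comm (f g : UnitAddTorus (Fin d) → ℝ) (k : Fin d → ℤ) :
    pairCoeff f g k = pairCoeff g f k := by
  rw [← pairCoeff_neg, pairCoeff, pairCoeff, neg_neg, mul_comm]

theorem pairCoeff_self (f : UnitAddTorus (Fin d) → ℝ) (k : Fin d → ℤ) :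
    pairCoeff f f k = ‖coeff f k‖ ^ 2 := by
  rw [pairCoeff, coeff_neg, Complex.mul_conj, Complex.ofReal_re, Complex.normSq_eq_norm_sq]

theorem pairCoeff_zero (f g : UnitAddTorus (Fin d) → ℝ) :
    pairCoeff f g 0 = (∫ x, f x ∂torusMeasure d) * ∫ x, g x ∂torusMeasure d := by
  rw [pairCoeff, neg_zero, coeff_zero, coeff_zero, ← Complex.ofReal_mul, Complex.ofReal_re]

/-- All decay in `k` is taken from `f`; `g` will be a signed power of `f`, for which only continuity
is available. -/
theorem abs_pairCoeff_le (f g : UnitAddTorus (Fin d) → ℝ) (k : Fin d → ℤ) :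
    |pairCoeff f g k| ≤ ‖coeff f k‖ * ∫ x, |g x| ∂torusMeasure d := by
  refine (Complex.abs_re_le_norm _).trans ?_
  rw [norm_mul]
  gcongr
  exact norm_coeff_le g _

theorem integral_mFourier_neg_mul (j k : Fin d → ℤ) :
    ∫ x, UnitAddTorus.mFourier (-k) x * UnitAddTorus.mFourier j x ∂torusMeasure d
      = if j = k then 1 else 0 := by
  have h := orthonormal_iff_ite.1 (UnitAddTorus.orthonormal_mFourier (d := Fin d)) k j
  rw [ContinuousMap.inner_toLp] at h
  simp only [← UnitAddTorus.mFourier_neg] at h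
  rw [eq_comm] at h
  simp only [eq_comm (a := k)] at h
  rw [h]
  refine integral_congr_ae (Eventually.of_forall fun x => ?_)
  simp [mul_comm]

theorem coeff_one (k : Fin d → ℤ) :
    coeff (fun _ : UnitAddTorus (Fin d) => (1 : ℝ)) k = if k = 0 then 1 else 0 := by
  rw [coeff_eq_integral]
  have := integral_mFourier_neg_mul 0 k
  simp only [UnitAddTorus.mFourier_zero, ContinuousMap.one_apply, eq_comm (a := (0 : Fin d → ℤ))]
    at this
  simpa using this

/-! ### The heat form as a double integral, and its spectral gap -/

/-- The character at `x - y` splits into one factor in `x` and one in `y`, and the series may be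
integrated termwise because the Gaussian weights alone are summable. -/
theorem hasSum_heatForm {u : ℝ} (hu : 0 < u) {f g : UnitAddTorus (Fin d) → ℝ}
    (hf : Continuous f) (hg : Continuous g) :
    HasSum (fun k => Real.exp (-u * freqNorm k ^ 2) * pairCoeff f g k)
      (∫ z, f z.1 * g z.2 * heatKernel u (z.1 - z.2)
        ∂(torusMeasure d).prod (torusMeasure d)) := by
  let T : (Fin d → ℤ) → UnitAddTorus (Fin d) × UnitAddTorus (Fin d) → ℂ := fun k z =>
    (Real.exp (-u * freqNorm k ^ 2) : ℂ) *
      ((UnitAddTorus.mFourier k z.1 * (f z.1 : ℂ)) * (UnitAddTorus.mFourier (-k) z.2 * (g z.2 : ℂ)))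
  have hT : ∀ k, Continuous (T k) := fun k => by fun_prop
  have hnorm : ∀ k z, ‖T k z‖ = Real.exp (-u * freqNorm k ^ 2) * (|f z.1| * |g z.2|) := fun k z => by
    simp only [T, norm_mul, norm_mFourier_apply, Complex.norm_real, Real.norm_eq_abs, Real.abs_exp,
      one_mul]
  have h := hasSum_integral_of_summable_integral_norm (fun k => integrable_torus_prod (hT k)) (by
    simp only [hnorm, integral_const_mul]
    exact (summable_exp_neg_freqNorm_sq hu).mul_right _)
  have h1 : ∀ k, ∫ z, T k z ∂(torusMeasure d).prod (torusMeasure d)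
      = (Real.exp (-u * freqNorm k ^ 2) : ℂ) * (coeff f (-k) * coeff g k) := fun k => by
    simp only [T, integral_const_mul]
    rw [integral_prod_mul (fun x => UnitAddTorus.mFourier k x * (f x : ℂ))
      (fun x => UnitAddTorus.mFourier (-k) x * (g x : ℂ)), coeff_eq_integral, coeff_eq_integral,
      neg_neg]
  have h2 : ∀ z, ∑' k, T k z = ((f z.1 * g z.2 * heatKernel u (z.1 - z.2) : ℝ) : ℂ) := fun z => by
    rw [Complex.ofReal_mul, ofReal_heatKernel hu, ← tsum_mul_left]
    refine tsum_congr fun k => ?_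
    have : UnitAddTorus.mFourier k (z.1 - z.2)
        = UnitAddTorus.mFourier k z.1 * UnitAddTorus.mFourier (-k) z.2 := by
      simp only [UnitAddTorus.mFourier, ContinuousMap.coe_mk, ← Finset.prod_mul_distrib]
      refine Finset.prod_congr rfl fun i _ => ?_
      rw [Pi.sub_apply, Pi.neg_apply, fourier_neg, sub_eq_add_neg, fourier_apply, fourier_apply,
        fourier_apply, smul_add, AddCircle.toCircle_add, smul_neg, AddCircle.toCircle_neg,
        Circle.coe_mul, Circle.coe_inv_eq_conj]
    simp only [T, this]
    push_cast
    ring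
  simp only [h1, h2] at h
  rw [integral_complex_ofReal] at h
  have h3 := Complex.hasSum_re h
  rw [Complex.ofReal_re] at h3
  refine h3.congr_fun fun k => ?_
  rw [Complex.re_ofReal_mul, ← pairCoeff_neg, pairCoeff, neg_neg]

/-- The bilinear form `∫ (e^{-uL} f) g`, where `L` has symbol `|k|^2`, as a Fourier series. -/
noncomputable def heatForm (u : ℝ) (f g : UnitAddTorus (Fin d) → ℝ) : ℝ :=
  ∑' k, Real.exp (-u * freqNorm k ^ 2) * pairCoeff f g k

/-- Pairing with the constant `1` leaves only the frequency `0`: the kernel has mass one in each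
variable. -/
theorem integral_heatKernel {u : ℝ} (hu : 0 < u) {f : UnitAddTorus (Fin d) → ℝ}
    (hf : Continuous f) :
    ∫ z, f z.1 * heatKernel u (z.1 - z.2) ∂(torusMeasure d).prod (torusMeasure d)
      = ∫ x, f x ∂torusMeasure d ∧
    ∫ z, f z.2 * heatKernel u (z.1 - z.2) ∂(torusMeasure d).prod (torusMeasure d)
      = ∫ x, f x ∂torusMeasure d := by
  have hone : ∀ k, k ≠ 0 → pairCoeff f (fun _ => 1) k = 0 := fun k hk => by
    rw [pairCoeff, coeff_one, if_neg (neg_ne_zero.2 hk), mul_zero, Complex.zero_re]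
  have hs : HasSum (fun k => Real.exp (-u * freqNorm k ^ 2) * pairCoeff f (fun _ => 1) k)
      (∫ x, f x ∂torusMeasure d) := by
    have := hasSum_single (f := fun k => Real.exp (-u * freqNorm k ^ 2) *
      pairCoeff f (fun _ => 1) k) 0 fun k hk => by rw [hone k hk, mul_zero]
    simpa [pairCoeff_zero, freqNorm_zero] using this
  have h1 := hasSum_heatForm hu hf (continuous_const (y := (1 : ℝ)))
  have h2 := hasSum_heatForm hu (continuous_const (y := (1 : ℝ))) hf
  simp only [pairCoeff_comm (fun _ => 1) f] at h2
  simp only [mul_one] at h1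
  simp only [one_mul] at h2
  exact ⟨h1.unique hs, h2.unique hs⟩

theorem integral_sub_mul_sub_heatKernel {u : ℝ} (hu : 0 < u) {f g : UnitAddTorus (Fin d) → ℝ}
    (hf : Continuous f) (hg : Continuous g) :
    ∫ z, (f z.1 - f z.2) * (g z.1 - g z.2) * heatKernel u (z.1 - z.2)
        ∂(torusMeasure d).prod (torusMeasure d)
      = 2 * (∫ x, f x * g x ∂torusMeasure d - heatForm u f g) := by
  have hK := continuous_heatKernel (d := d) hu
  have e1 := (integral_heatKernel hu (f := fun x => f x * g x) (hf.mul hg)).1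
  have e2 := (integral_heatKernel hu (f := fun x => f x * g x) (hf.mul hg)).2
  have e3 := (hasSum_heatForm hu hf hg).tsum_eq
  have e4 := (hasSum_heatForm hu hg hf).tsum_eq
  simp only [pairCoeff_comm g f] at e4
  have hsplit : ∀ z : UnitAddTorus (Fin d) × UnitAddTorus (Fin d),
      (f z.1 - f z.2) * (g z.1 - g z.2) * heatKernel u (z.1 - z.2)
      = (f z.1 * g z.1 * heatKernel u (z.1 - z.2) + f z.2 * g z.2 * heatKernel u (z.1 - z.2))
        - (f z.1 * g z.2 * heatKernel u (z.1 - z.2) + g z.1 * f z.2 * heatKernel u (z.1 - z.2)) :=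
    fun z => by ring
  simp only [hsplit]
  rw [integral_sub, integral_add, integral_add]
  · rw [heatForm]
    linarith
  all_goals exact integrable_torus_prod (by fun_prop)

theorem integral_sub_mul_sub {f g : UnitAddTorus (Fin d) → ℝ}
    (hf : Continuous f) (hg : Continuous g) :
    ∫ z, (f z.1 - f z.2) * (g z.1 - g z.2) ∂(torusMeasure d).prod (torusMeasure d)
      = 2 * (∫ x, f x * g x ∂torusMeasure d
        - (∫ x, f x ∂torusMeasure d) * ∫ x, g x ∂torusMeasure d) := by
  have e1 := integral_prod_mul (μ := torusMeasure d) (ν := torusMeasure d)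
    (fun x => f x * g x) (fun _ => (1 : ℝ))
  have e2 := integral_prod_mul (μ := torusMeasure d) (ν := torusMeasure d)
    (fun _ => (1 : ℝ)) (fun x => f x * g x)
  have e3 := integral_prod_mul (μ := torusMeasure d) (ν := torusMeasure d) f g
  have e4 := integral_prod_mul (μ := torusMeasure d) (ν := torusMeasure d) g f
  simp only [mul_one, one_mul, integral_const, probReal_univ, smul_eq_mul] at e1 e2
  have hsplit : ∀ z : UnitAddTorus (Fin d) × UnitAddTorus (Fin d),
      (f z.1 - f z.2) * (g z.1 - g z.2)
      = (f z.1 * g z.1 + f z.2 * g z.2) - (f z.1 * g z.2 + g z.1 * f z.2) :=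
    fun z => by ring
  simp only [hsplit]
  rw [integral_sub, integral_add, integral_add]
  · linarith
  all_goals exact integrable_torus_prod (by fun_prop)

/-- By Parseval: nonzero frequencies satisfy `|k| ≥ 1`, so their weight is at most `e^{-u}`; the
last term restores the undamped frequency `0`. -/
theorem heatForm_self_le {u : ℝ} (hu : 0 < u) {f : UnitAddTorus (Fin d) → ℝ} (hf : Continuous f) :
    heatForm u f f ≤ Real.exp (-u) * ∫ x, f x ^ 2 ∂torusMeasure d
      + (1 - Real.exp (-u)) * (∫ x, f x ∂torusMeasure d) ^ 2 := by
  have h1 := (hasSum_sq_coeff hf).mul_left (Real.exp (-u))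
  have h2 : HasSum (fun k : Fin d → ℤ =>
      if k = 0 then (1 - Real.exp (-u)) * (∫ x, f x ∂torusMeasure d) ^ 2 else 0)
      ((1 - Real.exp (-u)) * (∫ x, f x ∂torusMeasure d) ^ 2) := hasSum_ite_eq 0 _
  refine hasSum_le (fun k => ?_) (hasSum_heatForm hu hf hf).summable.hasSum (h1.add h2)
  rcases eq_or_ne k 0 with rfl | hk
  · rw [if_pos rfl, pairCoeff_zero, freqNorm_zero, coeff_zero, Complex.norm_real, Real.norm_eq_abs,
      sq_abs]
    simp only [ne_eq, OfNat.ofNat_ne_zero, not_false_eq_true, zero_pow, mul_zero, Real.exp_zero]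
    nlinarith
  · rw [if_neg hk, add_zero, pairCoeff_self]
    gcongr
    nlinarith [one_le_freqNorm_sq hk]

/-- The spectral gap of the heat semigroup in `L^p`, at the level of its bilinear form. -/
theorem heatForm_gap {p : ℝ} (hp : 1 < p) {u : ℝ} (hu : 0 < u) {f : UnitAddTorus (Fin d) → ℝ}
    (hf : Continuous f) (hmean : ∫ x, f x ∂torusMeasure d = 0) :
    powConst (2 / p) / 2 * (1 - Real.exp (-u)) * ∫ x, |f x| ^ p ∂torusMeasure d
      ≤ ∫ x, |f x| ^ p ∂torusMeasure d - heatForm u f (fun x => signedPow (p - 1) (f x)) := by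
  have hp0 : 0 < p := by linarith
  have hr0 : 0 < 2 / p := by positivity
  have hr2 : 2 / p < 2 := by
    rw [div_lt_iff₀ hp0]
    linarith
  have hq : 0 < p / 2 := by positivity
  -- The half power satisfies `g^2 = |f|^p`; the signed powers of `g` with exponents `2/p` and `2 -
  -- 2/p` recover `f` and `h`.
  set g : UnitAddTorus (Fin d) → ℝ := fun x => signedPow (p / 2) (f x) with hg
  set h : UnitAddTorus (Fin d) → ℝ := fun x => signedPow (p - 1) (f x) with hh
  have hgc : Continuous g := (continuous_signedPow hq).comp hf
  have hhc : Continuous h := (continuous_signedPow (by linarith)).comp hf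
  have hfg : ∀ x, signedPow (2 / p) (g x) = f x := fun x => by
    rw [hg]
    simp only
    rw [signedPow_signedPow hr0 hq, div_mul_div_cancel₀ (by norm_num), div_self hp0.ne',
      signedPow_one]
  have hhg : ∀ x, signedPow (2 - 2 / p) (g x) = h x := fun x => by
    rw [hg, hh]
    simp only
    rw [signedPow_signedPow (by linarith) hq]
    congr 1
    field_simp
  have hcomp : ∀ x y, powConst (2 / p) * ((g x - g y) * (g x - g y)) ≤
      (f x - f y) * (h x - h y) ∧ (f x - f y) * (h x - h y) ≤ 2 * ((g x - g y) * (g x - g y)) :=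
    fun x y => by
      have := signedPow_comparison hr0 hr2 (g x) (g y)
      rwa [hfg, hfg, hhg, hhg, pow_two] at this
  have hfh : ∫ x, f x * h x ∂torusMeasure d = ∫ x, |f x| ^ p ∂torusMeasure d := by
    refine integral_congr_ae (Eventually.of_forall fun x => ?_)
    change f x * signedPow (p - 1) (f x) = _
    rw [mul_signedPow (by linarith), sub_add_cancel]
  have hK := continuous_heatKernel (d := d) hu
  have i1 : powConst (2 / p) * ∫ z, (g z.1 - g z.2) * (g z.1 - g z.2) * heatKernel u (z.1 - z.2)
        ∂(torusMeasure d).prod (torusMeasure d)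
      ≤ ∫ z, (f z.1 - f z.2) * (h z.1 - h z.2) * heatKernel u (z.1 - z.2)
        ∂(torusMeasure d).prod (torusMeasure d) := by
    rw [← integral_const_mul]
    refine integral_mono (integrable_torus_prod (by fun_prop)) (integrable_torus_prod (by fun_prop))
      fun z => ?_
    simp only
    rw [← mul_assoc]
    exact mul_le_mul_of_nonneg_right (hcomp _ _).1 (heatKernel_nonneg hu _)
  -- Without the kernel, the upper comparison bounds the variance of `g` from below by `½ ∫ |f|^p`;
  -- the mean of `f` vanishes, so no product of means is subtracted on the left.
  have i2 : ∫ z, (f z.1 - f z.2) * (h z.1 - h z.2) ∂(torusMeasure d).prod (torusMeasure d)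
      ≤ 2 * ∫ z, (g z.1 - g z.2) * (g z.1 - g z.2) ∂(torusMeasure d).prod (torusMeasure d) := by
    rw [← integral_const_mul]
    exact integral_mono (integrable_torus_prod (by fun_prop)) (integrable_torus_prod (by fun_prop))
      fun z => (hcomp _ _).2
  rw [integral_sub_mul_sub_heatKernel hu hgc hgc, integral_sub_mul_sub_heatKernel hu hf hhc, hfh]
    at i1
  rw [integral_sub_mul_sub hf hhc, integral_sub_mul_sub hgc hgc, hfh, hmean, zero_mul, sub_zero]
    at i2
  have i3 := heatForm_self_le hu hgc
  simp only [pow_two] at i3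
  have hc := powConst_pos hr0 hr2
  have he : 0 ≤ 1 - Real.exp (-u) := by
    rw [sub_nonneg, Real.exp_le_one_iff]
    linarith
  set V := ∫ x, g x * g x ∂torusMeasure d
  set M := ∫ x, g x ∂torusMeasure d
  set E := ∫ x, |f x| ^ p ∂torusMeasure d
  have j1 : (1 - Real.exp (-u)) * (V - M * M) ≤ V - heatForm u g g := by linarith
  have j2 : E / 2 ≤ V - M * M := by linarith
  calc powConst (2 / p) / 2 * (1 - Real.exp (-u)) * E
      = powConst (2 / p) * ((1 - Real.exp (-u)) * (E / 2)) := by ring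
    _ ≤ powConst (2 / p) * ((1 - Real.exp (-u)) * (V - M * M)) := by gcongr
    _ ≤ powConst (2 / p) * (V - heatForm u g g) := by gcongr
    _ ≤ _ := by linarith

/-! ### Subordination: from the heat semigroup to fractional powers -/

/-- The bound separates `l` from `u`, leaving a function of `u` that is integrable against
`u^{-1-σ}` both at `0` and at infinity. -/
theorem one_sub_exp_neg_le_mul_min {l u : ℝ} (hl : 0 ≤ l) (hu : 0 ≤ u) :
    1 - Real.exp (-u * l) ≤ (1 + l) * min u 1 := by
  rcases le_total u 1 with h | h
  · rw [min_eq_left h]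
    nlinarith [Real.add_one_le_exp (-u * l)]
  · rw [min_eq_right h]
    nlinarith [Real.exp_pos (-u * l)]

theorem one_sub_exp_neg_nonneg {l u : ℝ} (hl : 0 ≤ l) (hu : 0 ≤ u) :
    0 ≤ 1 - Real.exp (-u * l) := by
  rw [sub_nonneg, Real.exp_le_one_iff]
  nlinarith

theorem integrableOn_min_mul_rpow {σ : ℝ} (h0 : 0 < σ) (h1 : σ < 1) :
    IntegrableOn (fun u : ℝ => min u 1 * u ^ (-1 - σ)) (Set.Ioi 0) := by
  rw [← Set.Ioc_union_Ioi_eq_Ioi zero_le_one]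
  refine IntegrableOn.union ?_ ?_
  · have := (intervalIntegral.intervalIntegrable_rpow' (a := 0) (b := 1) (r := -σ)
      (by linarith)).1
    refine this.congr_fun (fun u hu => ?_) measurableSet_Ioc
    rw [min_eq_left hu.2, ← Real.rpow_one_add' hu.1.le (by linarith)]
    ring_nf
  · refine (integrableOn_Ioi_rpow_of_lt (a := -1 - σ) (by linarith) zero_lt_one).congr_fun
      (fun u hu => ?_) measurableSet_Ioi
    rw [min_eq_right (le_of_lt hu), one_mul]

theorem integrableOn_one_sub_exp_neg_mul_rpow {σ l : ℝ} (h0 : 0 < σ) (h1 : σ < 1) (hl : 0 ≤ l) :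
    IntegrableOn (fun u : ℝ => (1 - Real.exp (-u * l)) * u ^ (-1 - σ)) (Set.Ioi 0) := by
  refine ((integrableOn_min_mul_rpow h0 h1).const_mul (1 + l)).mono'
    (by fun_prop) ?_
  filter_upwards [ae_restrict_mem measurableSet_Ioi] with u hu
  have hu' : (0 : ℝ) < u := hu
  rw [Real.norm_eq_abs, abs_of_nonneg (mul_nonneg (one_sub_exp_neg_nonneg hl hu'.le)
    (Real.rpow_nonneg hu'.le _)), ← mul_assoc]
  gcongr
  exact one_sub_exp_neg_le_mul_min hl hu'.le

/-- The substitution `u ↦ l u` extracts the power `l^σ`. -/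
theorem integral_one_sub_exp_neg_mul_rpow {σ l : ℝ} (h0 : 0 < σ) (hl : 0 ≤ l) :
    ∫ u in Set.Ioi (0 : ℝ), (1 - Real.exp (-u * l)) * u ^ (-1 - σ)
      = l ^ σ * ∫ u in Set.Ioi (0 : ℝ), (1 - Real.exp (-u)) * u ^ (-1 - σ) := by
  rcases hl.eq_or_lt with rfl | hl
  · simp [Real.zero_rpow h0.ne']
  have h := integral_comp_mul_left_Ioi (fun u : ℝ => (1 - Real.exp (-u)) * u ^ (-1 - σ)) 0 hl
  rw [mul_zero, smul_eq_mul] at h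
  have h' : ∫ u in Set.Ioi (0 : ℝ), (1 - Real.exp (-u * l)) * u ^ (-1 - σ)
      = l ^ (1 + σ) * ∫ u in Set.Ioi (0 : ℝ), (1 - Real.exp (-(l * u))) * (l * u) ^ (-1 - σ) := by
    rw [← integral_const_mul]
    refine setIntegral_congr_fun measurableSet_Ioi fun u hu => ?_
    have hu' : (0 : ℝ) < u := hu
    rw [Real.mul_rpow hl.le hu'.le]
    have : l ^ (1 + σ) * l ^ (-1 - σ) = 1 := by
      rw [← Real.rpow_add hl]
      simp
    calc _ = (l ^ (1 + σ) * l ^ (-1 - σ)) * ((1 - Real.exp (-u * l)) * u ^ (-1 - σ)) := by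
          rw [this, one_mul]
      _ = _ := by
          rw [show -(l * u) = -u * l by ring]
          ring
  rw [h', h, ← mul_assoc]
  congr 1
  rw [Real.rpow_add hl, Real.rpow_one]
  field_simp

theorem integral_one_sub_exp_neg_mul_rpow_pos {σ : ℝ} (h0 : 0 < σ) (h1 : σ < 1) :
    0 < ∫ u in Set.Ioi (0 : ℝ), (1 - Real.exp (-u)) * u ^ (-1 - σ) := by
  have hint := integrableOn_one_sub_exp_neg_mul_rpow h0 h1 zero_le_one
  simp only [mul_one] at hint
  have hpos : ∀ u : ℝ, 0 < u → 0 < (1 - Real.exp (-u)) * u ^ (-1 - σ) := fun u hu => by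
    have : Real.exp (-u) < 1 := by
      rw [Real.exp_lt_one_iff]
      linarith
    have := Real.rpow_pos_of_pos hu (-1 - σ)
    nlinarith
  rw [setIntegral_pos_iff_support_of_nonneg_ae _ hint]
  · refine lt_of_lt_of_le ?_ (measure_mono (s := Set.Ioi (0 : ℝ)) fun u hu =>
      ⟨(hpos u hu).ne', hu⟩)
    simp
  · filter_upwards [ae_restrict_mem measurableSet_Ioi] with u hu
    exact (hpos u hu).le

/-- If all the increments `∑ (1 - e^{-u λ}) b` of a diagonal semigroup are nonnegative, then so is
the quadratic form of every fractional power `σ ≤ 1` of its generator. -/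
theorem tsum_rpow_mul_nonneg {ι : Type*} [Countable ι] {l b : ι → ℝ} (hl : ∀ k, 0 ≤ l k)
    (hb : Summable fun k => (1 + l k) * |b k|)
    (h : ∀ u : ℝ, 0 < u → 0 ≤ ∑' k, (1 - Real.exp (-u * l k)) * b k)
    {σ : ℝ} (h0 : 0 < σ) (h1 : σ ≤ 1) : 0 ≤ ∑' k, l k ^ σ * b k := by
  rcases h1.eq_or_lt with rfl | h1
  -- At `σ = 1` the subordination integral diverges at `0`; the symbol is recovered instead as the
  -- derivative of `1 - e^{-uλ}` at `u = 0`.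
  · have key : Tendsto (fun u : ℝ => ∑' k, (u⁻¹ * (1 - Real.exp (-u * l k))) * b k) (𝓝[>] 0)
        (𝓝 (∑' k, l k ^ (1 : ℝ) * b k)) := by
      refine tendsto_tsum_of_dominated_convergence hb (fun k => ?_) ?_
      · refine Tendsto.mul_const _ ?_
        have hd : HasDerivAt (fun u : ℝ => 1 - Real.exp (-u * l k)) (l k) 0 := by
          have := (((hasDerivAt_id (0 : ℝ)).neg.mul_const (l k)).exp).const_sub 1
          simpa using this
        simpa using hd.tendsto_slope_zero_right
      · filter_upwards [self_mem_nhdsWithin] with u hu k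
        have hu' : (0 : ℝ) < u := hu
        have hn := one_sub_exp_neg_nonneg (hl k) hu'.le
        rw [Real.norm_eq_abs, abs_mul, abs_of_nonneg (by positivity)]
        gcongr
        rw [inv_mul_le_iff₀ hu']
        nlinarith [Real.add_one_le_exp (-u * l k)]
    refine ge_of_tendsto key ?_
    filter_upwards [self_mem_nhdsWithin] with u hu
    have hu' : (0 : ℝ) < u := hu
    simp only [mul_assoc]
    rw [tsum_mul_left]
    exact mul_nonneg (by positivity) (h u hu')
  -- For `σ < 1` the hypothesis is integrated against `u^{-1-σ} du`; sum and integral are exchanged,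
  -- and the positive factor `K` cancels.
  · set K := ∫ u in Set.Ioi (0 : ℝ), (1 - Real.exp (-u)) * u ^ (-1 - σ)
    have hK : 0 < K := integral_one_sub_exp_neg_mul_rpow_pos h0 h1
    let F : ι → ℝ → ℝ := fun k u => (1 - Real.exp (-u * l k)) * u ^ (-1 - σ) * b k
    have hF : ∀ k, IntegrableOn (F k) (Set.Ioi 0) := fun k =>
      (integrableOn_one_sub_exp_neg_mul_rpow h0 h1 (hl k)).mul_const _
    have hsum : Summable fun k => ∫ u in Set.Ioi (0 : ℝ), ‖F k u‖ := by
      refine Summable.of_nonneg_of_le (fun k => integral_nonneg fun u => norm_nonneg _)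
        (fun k => ?_) (hb.mul_right (∫ u in Set.Ioi (0 : ℝ), min u 1 * u ^ (-1 - σ)))
      rw [← integral_const_mul]
      refine setIntegral_mono_on (hF k).norm ((integrableOn_min_mul_rpow h0 h1).const_mul _)
        measurableSet_Ioi fun u hu => ?_
      have hu' : (0 : ℝ) < u := hu
      simp only [F]
      rw [norm_mul, Real.norm_eq_abs, Real.norm_eq_abs,
        abs_of_nonneg (mul_nonneg (one_sub_exp_neg_nonneg (hl k) hu'.le)
          (Real.rpow_nonneg hu'.le _))]
      calc _ ≤ ((1 + l k) * min u 1) * u ^ (-1 - σ) * |b k| := by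
            gcongr
            exact one_sub_exp_neg_le_mul_min (hl k) hu'.le
        _ = _ := by ring
    have hmain := hasSum_integral_of_summable_integral_norm hF hsum
    have hterm : ∀ k, ∫ u in Set.Ioi (0 : ℝ), F k u = K * (l k ^ σ * b k) := fun k => by
      simp only [F]
      rw [integral_mul_const, integral_one_sub_exp_neg_mul_rpow h0 (hl k)]
      ring
    simp only [hterm] at hmain
    have hnonneg : 0 ≤ ∫ u in Set.Ioi (0 : ℝ), ∑' k, F k u := by
      refine setIntegral_nonneg measurableSet_Ioi fun u hu => ?_
      have hu' : (0 : ℝ) < u := hu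
      have : ∀ k, F k u = u ^ (-1 - σ) * ((1 - Real.exp (-u * l k)) * b k) := fun k => by
        simp only [F]
        ring
      simp only [this]
      rw [tsum_mul_left]
      exact mul_nonneg (Real.rpow_nonneg hu'.le _) (h u hu')
    rw [← hmain.tsum_eq, tsum_mul_left] at hnonneg
    exact nonneg_of_mul_nonneg_right hnonneg hK

theorem hasSum_option {ι : Type*} {f : Option ι → ℝ} {a : ℝ} (h : HasSum (fun k => f (some k)) a) :
    HasSum f (a + f none) := by
  classical
  have h1 : HasSum (fun o : Option ι => o.elim 0 fun k => f (some k)) a := by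
    refine ((Option.some_injective ι).hasSum_iff fun o ho => ?_).1 h
    cases o with
    | none => rfl
    | some k => exact absurd ⟨k, rfl⟩ ho
  refine (h1.add (hasSum_ite_eq none (f none))).congr_fun fun o => ?_
  cases o <;> simp

theorem le_tsum_rpow_mul {ι : Type*} [Countable ι] {l b : ι → ℝ} (hl : ∀ k, 0 ≤ l k)
    (hb : Summable fun k => (1 + l k) * |b k|) {E : ℝ}
    (h : ∀ u : ℝ, 0 < u → (1 - Real.exp (-u)) * E ≤ ∑' k, (1 - Real.exp (-u * l k)) * b k)
    {σ : ℝ} (h0 : 0 < σ) (h1 : σ ≤ 1) : E ≤ ∑' k, l k ^ σ * b k := by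
  have hs : ∀ w : ℝ → ℝ, (∀ x, 0 ≤ x → |w x| ≤ 1 + x) → Summable fun k => w (l k) * b k :=
    fun w hw => Summable.of_norm_bounded hb fun k => by
      rw [norm_mul, Real.norm_eq_abs, Real.norm_eq_abs]
      gcongr
      exact hw _ (hl k)
  -- One extra mode with eigenvalue `1` and weight `-E` absorbs the left side at once for all `u`;
  -- since `1^σ = 1`, it contributes exactly `-E` to the conclusion.
  let l' : Option ι → ℝ := fun o => o.elim 1 l
  let b' : Option ι → ℝ := fun o => o.elim (-E) b
  have hopt : ∀ w : ℝ → ℝ, (∀ x, 0 ≤ x → |w x| ≤ 1 + x) →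
      ∑' o, w (l' o) * b' o = ∑' k, w (l k) * b k - w 1 * E := fun w hw => by
    have := hasSum_option (f := fun o => w (l' o) * b' o) (hs w hw).hasSum
    rw [this.tsum_eq]
    simp only [l', b', Option.elim_none]
    ring
  have key := tsum_rpow_mul_nonneg (l := l') (b := b') (fun o => by cases o <;> simp [l', hl])
    (hasSum_option (f := fun o => (1 + l' o) * |b' o|) hb.hasSum).summable (fun u hu => by
      rw [hopt (fun x => 1 - Real.exp (-u * x)) fun x hx => by
        rw [abs_of_nonneg (one_sub_exp_neg_nonneg hx hu.le)]
        linarith [Real.exp_pos (-u * x)]]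
      have := h u hu
      rw [mul_one]
      linarith) h0 h1
  rw [hopt (fun x => x ^ σ) fun x hx => by
    rw [abs_of_nonneg (Real.rpow_nonneg hx σ)]
    rcases le_total x 1 with hx1 | hx1
    · linarith [Real.rpow_le_one hx hx1 h0.le]
    · have := Real.rpow_le_rpow_of_exponent_le hx1 h1
      rw [Real.rpow_one] at this
      linarith, Real.one_rpow] at key
  linarith

/-! ### Fourier multipliers and the Poincaré-type inequality -/

/-- Continuous functions whose Laplacian has an absolutely convergent Fourier series. -/
structure HasSummableLaplacian (f : UnitAddTorus (Fin d) → ℝ) : Prop where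
  continuous : Continuous f
  summable : Summable fun k => (1 + freqNorm k ^ 2) * ‖coeff f k‖

theorem HasSummableLaplacian.summable_mul {f : UnitAddTorus (Fin d) → ℝ}
    (hf : HasSummableLaplacian f) {m : (Fin d → ℤ) → ℝ} (hm : ∀ k, |m k| ≤ 1 + freqNorm k ^ 2) :
    Summable fun k => |m k| * ‖coeff f k‖ :=
  Summable.of_nonneg_of_le (fun k => by positivity) (fun k => by gcongr; exact hm k) hf.summable

theorem freqNorm_rpow_le {s : ℝ} (h0 : 0 < s) (h2 : s ≤ 2) (k : Fin d → ℤ) :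
    freqNorm k ^ s ≤ 1 + freqNorm k ^ 2 := by
  rcases le_total (freqNorm k) 1 with h | h
  · nlinarith [Real.rpow_le_one (freqNorm_nonneg k) h h0.le, sq_nonneg (freqNorm k)]
  · have := Real.rpow_le_rpow_of_exponent_le h h2
    rw [Real.rpow_two] at this
    linarith

theorem norm_multiplierSeries_term (m : (Fin d → ℤ) → ℝ) (f : UnitAddTorus (Fin d) → ℝ)
    (x : UnitAddTorus (Fin d)) (k : Fin d → ℤ) :
    ‖(m k : ℂ) * coeff f k * UnitAddTorus.mFourier k x‖ = |m k| * ‖coeff f k‖ := by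
  rw [norm_mul, norm_mul, norm_mFourier_apply, mul_one, Complex.norm_real, Real.norm_eq_abs]

theorem abs_fourierMultiplier_le {m : (Fin d → ℤ) → ℝ} {f : UnitAddTorus (Fin d) → ℝ}
    (hm : Summable fun k => |m k| * ‖coeff f k‖) (x : UnitAddTorus (Fin d)) :
    |fourierMultiplier m f x| ≤ ∑' k, |m k| * ‖coeff f k‖ :=
  (Complex.abs_re_le_norm _).trans
    (tsum_of_norm_bounded hm.hasSum fun k => (norm_multiplierSeries_term m f x k).le)

theorem continuous_fourierMultiplier {m : (Fin d → ℤ) → ℝ} {f : UnitAddTorus (Fin d) → ℝ}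
    (hm : Summable fun k => |m k| * ‖coeff f k‖) : Continuous (fourierMultiplier m f) :=
  Complex.continuous_re.comp (continuous_tsum (fun k => by fun_prop) hm
    fun k x => (norm_multiplierSeries_term m f x k).le)

theorem hasSum_integral_multiplierSeries_mul {m : (Fin d → ℤ) → ℝ}
    {f : UnitAddTorus (Fin d) → ℝ} (hm : Summable fun k => |m k| * ‖coeff f k‖)
    {g : UnitAddTorus (Fin d) → ℂ} (hg : Continuous g) :
    HasSum (fun k => (m k : ℂ) * coeff f k *
        ∫ x, UnitAddTorus.mFourier k x * g x ∂torusMeasure d)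
      (∫ x, multiplierSeries m f x * g x ∂torusMeasure d) := by
  have h := hasSum_integral_of_summable_integral_norm (μ := torusMeasure d)
    (F := fun k x => (m k : ℂ) * coeff f k * (UnitAddTorus.mFourier k x * g x))
    (fun k => integrable_torus (by fun_prop)) (by
      have : ∀ k x, ‖(m k : ℂ) * coeff f k * (UnitAddTorus.mFourier k x * g x)‖
          = |m k| * ‖coeff f k‖ * ‖g x‖ := fun k x => by
        rw [← mul_assoc, norm_mul, norm_multiplierSeries_term]
      simp only [this, integral_const_mul]
      exact hm.mul_right _)
  have hsum : ∀ x, ∑' k, (m k : ℂ) * coeff f k * (UnitAddTorus.mFourier k x * g x)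
      = multiplierSeries m f x * g x := fun x => by
    rw [multiplierSeries, ← tsum_mul_right]
    exact tsum_congr fun k => (mul_assoc _ _ _).symm
  simp only [integral_const_mul, hsum] at h
  exact h

theorem hasSum_integral_fourierMultiplier_mul {m : (Fin d → ℤ) → ℝ} (hev : ∀ k, m (-k) = m k)
    {f : UnitAddTorus (Fin d) → ℝ} (hm : Summable fun k => |m k| * ‖coeff f k‖)
    {g : UnitAddTorus (Fin d) → ℝ} (hg : Continuous g) :
    HasSum (fun k => m k * pairCoeff f g k)
      (∫ x, fourierMultiplier m f x * g x ∂torusMeasure d) := by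
  have h := hasSum_integral_multiplierSeries_mul hm (g := fun x => (g x : ℂ)) (by fun_prop)
  simp only [← ofReal_fourierMultiplier hev, ← Complex.ofReal_mul] at h
  rw [integral_complex_ofReal] at h
  have h2 := Complex.hasSum_re h
  rw [Complex.ofReal_re] at h2
  refine h2.congr_fun fun k => ?_
  rw [mul_assoc, Complex.re_ofReal_mul, pairCoeff, coeff_eq_integral g, neg_neg]

theorem coeff_fourierMultiplier {m : (Fin d → ℤ) → ℝ} (hev : ∀ k, m (-k) = m k)
    {f : UnitAddTorus (Fin d) → ℝ} (hm : Summable fun k => |m k| * ‖coeff f k‖) (k : Fin d → ℤ) :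
    coeff (fourierMultiplier m f) k = m k * coeff f k := by
  have h := hasSum_integral_multiplierSeries_mul hm
    (g := fun x => UnitAddTorus.mFourier (-k) x) (by fun_prop)
  simp only [← ofReal_fourierMultiplier hev] at h
  have h2 : ∀ j, ∫ x, UnitAddTorus.mFourier j x * UnitAddTorus.mFourier (-k) x ∂torusMeasure d
      = if j = k then 1 else 0 := fun j => by
    rw [← integral_mFourier_neg_mul]
    simp only [mul_comm]
  simp only [h2] at h
  have h3 := h.unique (hasSum_single k fun j hj => by rw [if_neg hj, mul_zero])
  rw [if_pos rfl, mul_one] at h3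
  rw [← h3, coeff_eq_integral]
  simp only [mul_comm]

/-- Fourier inversion. It yields Parseval for `∫ f h` below and identifies the semigroup at time
zero. -/
theorem fourierMultiplier_one {f : UnitAddTorus (Fin d) → ℝ} (hf : HasSummableLaplacian f)
    (x : UnitAddTorus (Fin d)) : fourierMultiplier (fun _ => 1) f x = f x := by
  let F : C(UnitAddTorus (Fin d), ℂ) := ⟨fun x => (f x : ℂ), by have := hf.continuous; fun_prop⟩
  have hs : Summable (UnitAddTorus.mFourierCoeff F) := by
    refine Summable.of_norm ?_
    have := hf.summable_mul (m := fun _ => 1) fun k => by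
      rw [abs_one]
      nlinarith [sq_nonneg (freqNorm k)]
    simpa only [abs_one, one_mul] using! this
  have h := (UnitAddTorus.hasSum_mFourier_series_apply_of_summable hs x).tsum_eq
  rw [fourierMultiplier, multiplierSeries]
  simp only [Complex.ofReal_one, one_mul]
  change (∑' k, UnitAddTorus.mFourierCoeff F k • UnitAddTorus.mFourier k x).re = f x
  rw [h]
  exact Complex.ofReal_re _

/-- The Poincaré-type inequality for `Λ^s` in `L^p`. -/
theorem HasSummableLaplacian.le_integral_fracLaplacian {f : UnitAddTorus (Fin d) → ℝ}
    (hf : HasSummableLaplacian f) (hmean : ∫ x, f x ∂torusMeasure d = 0)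
    {s p : ℝ} (hs0 : 0 < s) (hs2 : s ≤ 2) (hp : 1 < p) :
    powConst (2 / p) / 2 * ∫ x, |f x| ^ p ∂torusMeasure d
      ≤ ∫ x, fracLaplacian s f x * |f x| ^ (p - 2) * f x ∂torusMeasure d := by
  set h : UnitAddTorus (Fin d) → ℝ := fun x => signedPow (p - 1) (f x) with hh
  have hhc : Continuous h := (continuous_signedPow (by linarith)).comp hf.continuous
  have hsum1 := hf.summable_mul (m := fun _ => 1) fun k => by
      rw [abs_one]
      nlinarith [sq_nonneg (freqNorm k)]
  have hb : Summable fun k => (1 + freqNorm k ^ 2) * |pairCoeff f h k| := by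
    refine Summable.of_nonneg_of_le (fun k => by positivity) (fun k => ?_)
      (hf.summable.mul_right (∫ x, |h x| ∂torusMeasure d))
    rw [mul_assoc]
    gcongr
    exact abs_pairCoeff_le f h k
  have h1 := hasSum_integral_fourierMultiplier_mul (fun _ => rfl) hsum1 hhc
  simp only [fourierMultiplier_one hf, one_mul] at h1
  have hfh : ∫ x, f x * h x ∂torusMeasure d = ∫ x, |f x| ^ p ∂torusMeasure d := by
    refine integral_congr_ae (Eventually.of_forall fun x => ?_)
    change f x * signedPow (p - 1) (f x) = _
    rw [mul_signedPow (by linarith), sub_add_cancel]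
  rw [hfh] at h1
  have h2 := hasSum_integral_fourierMultiplier_mul (m := fun k => freqNorm k ^ s)
    (fun k => by rw [freqNorm_neg]) (hf.summable_mul fun k => by
      rw [abs_of_nonneg (Real.rpow_nonneg (freqNorm_nonneg k) s)]
      exact freqNorm_rpow_le hs0 hs2 k) hhc
  -- With eigenvalues `|k|^2` and `σ = s/2`, the required hypothesis is `heatForm_gap` written as a
  -- Fourier series.
  have key := le_tsum_rpow_mul (l := fun k : Fin d → ℤ => freqNorm k ^ 2) (b := pairCoeff f h)
    (E := powConst (2 / p) / 2 * ∫ x, |f x| ^ p ∂torusMeasure d) (fun k => sq_nonneg _) hb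
    (fun u hu => by
      have h3 := h1.sub (hasSum_heatForm hu hf.continuous hhc).summable.hasSum
      have h4 : ∀ k, pairCoeff f h k - Real.exp (-u * freqNorm k ^ 2) * pairCoeff f h k
          = (1 - Real.exp (-u * freqNorm k ^ 2)) * pairCoeff f h k := fun k => by ring
      simp only [h4] at h3
      rw [h3.tsum_eq]
      have := heatForm_gap hp hu hf.continuous hmean
      rw [heatForm] at this
      linarith) (σ := s / 2) (by linarith) (by linarith)
  have h5 : ∀ k : Fin d → ℤ, (freqNorm k ^ 2) ^ (s / 2) = freqNorm k ^ s := fun k => by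
    rw [← Real.rpow_two, ← Real.rpow_mul (freqNorm_nonneg k)]
    congr 1
    ring
  simp only [h5] at key
  rw [h2.tsum_eq] at key
  refine key.trans_eq (integral_congr_ae (Eventually.of_forall fun x => ?_))
  simp only [hh, signedPow, fracLaplacian]
  rw [show p - 1 - 1 = p - 2 by ring]
  ring

/-! ### Derivatives on the torus and decay of Fourier coefficients -/

/-- The covering map `ℝ^d → 𝕋^d`. -/
def torusMk (x : Fin d → ℝ) : UnitAddTorus (Fin d) := fun i => (x i : UnitAddCircle)

theorem isOpenQuotientMap_torusMk : IsOpenQuotientMap (torusMk (d := d)) :=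
  IsOpenQuotientMap.piMap fun _ => QuotientAddGroup.isOpenQuotientMap_mk

theorem torusMk_add_single (y : Fin d → ℝ) (i : Fin d) (h : ℝ) :
    torusMk y + Pi.single i (h : UnitAddCircle) = torusMk (y + Pi.single i h) := by
  funext j
  rcases eq_or_ne j i with rfl | hj
  · simp [torusMk]
  · simp [torusMk, hj]

theorem TorusSmooth.continuous {f : UnitAddTorus (Fin d) → ℝ} (hf : TorusSmooth f) :
    Continuous f :=
  isOpenQuotientMap_torusMk.isQuotientMap.continuous_iff.2 (ContDiff.continuous hf)

/-- The partial derivative of a function on the torus. -/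
noncomputable def torusDeriv (i : Fin d) (f : UnitAddTorus (Fin d) → ℝ)
    (x : UnitAddTorus (Fin d)) : ℝ :=
  deriv (fun h : ℝ => f (x + Pi.single i (h : UnitAddCircle))) 0

theorem TorusSmooth.hasDerivAt_lift {f : UnitAddTorus (Fin d) → ℝ} (hf : TorusSmooth f)
    (i : Fin d) (y : Fin d → ℝ) (h : ℝ) :
    HasDerivAt (fun h : ℝ => f (torusMk y + Pi.single i (h : UnitAddCircle)))
      (fderiv ℝ (fun z => f (torusMk z)) (y + Pi.single i h) (Pi.single i 1)) h := by
  simp only [torusMk_add_single]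
  have h1 : HasFDerivAt (fun z => f (torusMk z)) (fderiv ℝ (fun z => f (torusMk z))
      (y + Pi.single i h)) (y + Pi.single i h) :=
    (ContDiff.differentiable hf (by simp) _).hasFDerivAt
  have h2 : HasDerivAt (fun h : ℝ => y + Pi.single i h) (Pi.single i 1) h :=
    (hasDerivAt_single i h).const_add y
  exact h1.comp_hasDerivAt h h2

theorem TorusSmooth.torusDeriv_torusMk {f : UnitAddTorus (Fin d) → ℝ} (hf : TorusSmooth f)
    (i : Fin d) (y : Fin d → ℝ) :
    torusDeriv i f (torusMk y) = fderiv ℝ (fun z => f (torusMk z)) y (Pi.single i 1) := by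
  have h := (hf.hasDerivAt_lift i y 0).deriv
  rw [Pi.single_zero, add_zero] at h
  exact h

theorem TorusSmooth.hasDerivAt {f : UnitAddTorus (Fin d) → ℝ} (hf : TorusSmooth f)
    (i : Fin d) (x : UnitAddTorus (Fin d)) (h : ℝ) :
    HasDerivAt (fun h : ℝ => f (x + Pi.single i (h : UnitAddCircle)))
      (torusDeriv i f (x + Pi.single i (h : UnitAddCircle))) h := by
  obtain ⟨y, rfl⟩ := isOpenQuotientMap_torusMk.surjective x
  rw [torusMk_add_single, hf.torusDeriv_torusMk]
  exact hf.hasDerivAt_lift i y h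

theorem TorusSmooth.torusDeriv {f : UnitAddTorus (Fin d) → ℝ} (hf : TorusSmooth f) (i : Fin d) :
    TorusSmooth (torusDeriv i f) := by
  have h : (fun z => TorusBernstein.torusDeriv i f (torusMk z))
      = fun z => fderiv ℝ (fun z => f (torusMk z)) z (Pi.single i 1) :=
    funext (hf.torusDeriv_torusMk i)
  change ContDiff ℝ _ (fun z => TorusBernstein.torusDeriv i f (torusMk z))
  rw [h]
  exact (ContDiff.fderiv_right (m := ((⊤ : ℕ∞) : WithTop ℕ∞)) hf (by simp)).clm_apply
    contDiff_const

theorem mFourier_add_apply (k : Fin d → ℤ) (x y : UnitAddTorus (Fin d)) :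
    UnitAddTorus.mFourier k (x + y) = UnitAddTorus.mFourier k x * UnitAddTorus.mFourier k y := by
  simp only [UnitAddTorus.mFourier, ContinuousMap.coe_mk, ← Finset.prod_mul_distrib]
  refine Finset.prod_congr rfl fun i _ => ?_
  rw [Pi.add_apply, fourier_apply, fourier_apply, fourier_apply, smul_add, AddCircle.toCircle_add,
    Circle.coe_mul]

theorem mFourier_single_coe (k : Fin d → ℤ) (i : Fin d) (h : ℝ) :
    UnitAddTorus.mFourier k (Pi.single i (h : UnitAddCircle))
      = Complex.exp (2 * Real.pi * Complex.I * k i * h) := by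
  simp only [UnitAddTorus.mFourier, ContinuousMap.coe_mk]
  rw [Finset.prod_eq_single i]
  · rw [Pi.single_eq_same, fourier_coe_apply]
    simp
  · intro j _ hj
    rw [Pi.single_eq_of_ne hj, fourier_eval_zero]
  · simp

theorem integral_mFourier_mul_translate (f : UnitAddTorus (Fin d) → ℝ) (k : Fin d → ℤ) (i : Fin d)
    (h : ℝ) :
    ∫ x, UnitAddTorus.mFourier (-k) x * (f (x + Pi.single i (h : UnitAddCircle)) : ℂ)
        ∂torusMeasure d
      = Complex.exp (2 * Real.pi * Complex.I * k i * h) * coeff f k := by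
  have h1 := integral_add_right_eq_self (μ := torusMeasure d)
    (fun x => UnitAddTorus.mFourier (-k) (x + Pi.single i ((-h : ℝ) : UnitAddCircle)) * (f x : ℂ))
    (Pi.single i (h : UnitAddCircle))
  have h2 : ∀ x : UnitAddTorus (Fin d), x + Pi.single i (h : UnitAddCircle)
      + Pi.single i ((-h : ℝ) : UnitAddCircle) = x := fun x => by
    rw [add_assoc, ← Pi.single_add, ← AddCircle.coe_add, add_neg_cancel, AddCircle.coe_zero,
      Pi.single_zero, add_zero]
  simp only [h2] at h1
  rw [h1, coeff_eq_integral, ← integral_const_mul]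
  refine integral_congr_ae (Eventually.of_forall fun x => ?_)
  simp only
  rw [mFourier_add_apply, mFourier_single_coe]
  simp only [Pi.neg_apply, Int.cast_neg, Complex.ofReal_neg, mul_neg, neg_mul, neg_neg]
  ring

/-- Translation by `h` in direction `i` multiplies the coefficient by `e^{2πi k_i h}`.
Differentiating this identity at `h = 0` replaces integration by parts. -/
theorem TorusSmooth.coeff_torusDeriv {f : UnitAddTorus (Fin d) → ℝ} (hf : TorusSmooth f)
    (i : Fin d) (k : Fin d → ℤ) :
    coeff (TorusBernstein.torusDeriv i f) k = 2 * Real.pi * Complex.I * k i * coeff f k := by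
  have hc := hf.continuous
  have hc' := (hf.torusDeriv i).continuous
  obtain ⟨C, hC⟩ := isCompact_univ.exists_bound_of_continuousOn hc'.continuousOn
  let F : ℝ → UnitAddTorus (Fin d) → ℂ := fun h x => UnitAddTorus.mFourier (-k) x *
    (f (x + Pi.single i (h : UnitAddCircle)) : ℂ)
  let F' : ℝ → UnitAddTorus (Fin d) → ℂ := fun h x => UnitAddTorus.mFourier (-k) x *
    (TorusBernstein.torusDeriv i f (x + Pi.single i (h : UnitAddCircle)) : ℂ)
  have hF : ∀ h, Continuous (F h) := fun h => by
    have := hc.comp (continuous_add_const (Pi.single i (h : UnitAddCircle)))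
    exact (UnitAddTorus.mFourier (-k)).continuous.mul (Complex.continuous_ofReal.comp this)
  have hF' : ∀ h, Continuous (F' h) := fun h => by
    have := hc'.comp (continuous_add_const (Pi.single i (h : UnitAddCircle)))
    exact (UnitAddTorus.mFourier (-k)).continuous.mul (Complex.continuous_ofReal.comp this)
  have hbound : ∀ x : UnitAddTorus (Fin d), ∀ h ∈ (Set.univ : Set ℝ), ‖F' h x‖ ≤ C :=
    fun x h _ => by
      simp only [F']
      rw [norm_mul, norm_mFourier_apply, one_mul, Complex.norm_real]
      exact hC _ (Set.mem_univ _)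
  have hdiff : ∀ x : UnitAddTorus (Fin d), ∀ h ∈ (Set.univ : Set ℝ),
      HasDerivAt (fun h => F h x) (F' h x) h := fun x h _ =>
    (hf.hasDerivAt i x h).ofReal_comp.const_mul _
  have h1 := (hasDerivAt_integral_of_dominated_loc_of_deriv_le (μ := torusMeasure d) (x₀ := (0 : ℝ))
    (bound := fun _ => C) univ_mem
    (Eventually.of_forall fun h => (integrable_torus (hF h)).aestronglyMeasurable)
    (integrable_torus (hF 0)) (integrable_torus (hF' 0)).aestronglyMeasurable
    (Eventually.of_forall hbound) (integrable_const C) (Eventually.of_forall hdiff)).2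
  simp only [F, integral_mFourier_mul_translate] at h1
  have h2 : HasDerivAt (fun h : ℝ => Complex.exp (2 * Real.pi * Complex.I * k i * h) * coeff f k)
      (2 * Real.pi * Complex.I * k i * coeff f k) 0 := by
    have := (((hasDerivAt_id (0 : ℝ)).ofReal_comp.const_mul
      (2 * Real.pi * Complex.I * k i)).cexp).mul_const (coeff f k)
    simpa using this
  rw [← h1.unique h2, coeff_eq_integral]
  simp only [F', AddCircle.coe_zero, Pi.single_zero, add_zero]

theorem TorusSmooth.exists_coeff_eq_one_add_sq_mul {f : UnitAddTorus (Fin d) → ℝ}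
    (hf : TorusSmooth f) (i : Fin d) :
    ∃ g, TorusSmooth g ∧ ∀ k, coeff g k = ((1 + (k i : ℝ) ^ 2 : ℝ) : ℂ) * coeff f k := by
  have hf2 := (hf.torusDeriv i).torusDeriv i
  -- The operator `1 - ∂_i^2 / (4π^2)` has symbol `1 + k_i^2`.
  refine ⟨fun x => f x - (4 * Real.pi ^ 2)⁻¹ *
    TorusBernstein.torusDeriv i (TorusBernstein.torusDeriv i f) x,
    ContDiff.sub hf (ContDiff.mul contDiff_const hf2), fun k => ?_⟩
  have hc := hf.continuous
  have hc2 := hf2.continuous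
  have e1 := (hf.torusDeriv i).coeff_torusDeriv i k
  rw [hf.coeff_torusDeriv i k] at e1
  rw [coeff_eq_integral]
  have : ∀ x, UnitAddTorus.mFourier (-k) x * ((f x - (4 * Real.pi ^ 2)⁻¹ *
      TorusBernstein.torusDeriv i (TorusBernstein.torusDeriv i f) x : ℝ) : ℂ)
      = UnitAddTorus.mFourier (-k) x * (f x : ℂ) - ((4 * Real.pi ^ 2 : ℝ) : ℂ)⁻¹ *
        (UnitAddTorus.mFourier (-k) x *
          (TorusBernstein.torusDeriv i (TorusBernstein.torusDeriv i f) x : ℂ)) := fun x => by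
    push_cast
    ring
  simp only [this]
  rw [integral_sub (integrable_torus (by fun_prop)) (integrable_torus (by fun_prop)),
    integral_const_mul, ← coeff_eq_integral, ← coeff_eq_integral, e1]
  have hpi : (Real.pi : ℂ) ≠ 0 := by exact_mod_cast Real.pi_ne_zero
  push_cast
  field_simp
  ring_nf
  rw [Complex.I_sq]
  ring

theorem TorusSmooth.exists_coeff_eq_prod_mul {f : UnitAddTorus (Fin d) → ℝ}
    (hf : TorusSmooth f) (S : Finset (Fin d)) :
    ∃ g, TorusSmooth g ∧
      ∀ k, coeff g k = ((∏ i ∈ S, (1 + (k i : ℝ) ^ 2) : ℝ) : ℂ) * coeff f k := by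
  induction S using Finset.induction_on with
  | empty => exact ⟨f, hf, fun k => by simp⟩
  | insert i S hi ih =>
    obtain ⟨g, hg, hgk⟩ := ih
    obtain ⟨g', hg', hgk'⟩ := hg.exists_coeff_eq_one_add_sq_mul i
    refine ⟨g', hg', fun k => ?_⟩
    rw [hgk', hgk, Finset.prod_insert hi, Complex.ofReal_mul, mul_assoc]

theorem one_add_sum_le_prod_one_add {ι : Type*} (S : Finset ι) {a : ι → ℝ} (ha : ∀ i, 0 ≤ a i) :
    1 + ∑ i ∈ S, a i ≤ ∏ i ∈ S, (1 + a i) := by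
  classical
  induction S using Finset.induction_on with
  | empty => simp
  | insert i S hi ih =>
    rw [Finset.sum_insert hi, Finset.prod_insert hi]
    have := Finset.sum_nonneg fun i (_ : i ∈ S) => ha i
    nlinarith [ha i]

theorem TorusSmooth.hasSummableLaplacian {f : UnitAddTorus (Fin d) → ℝ} (hf : TorusSmooth f) :
    HasSummableLaplacian f := by
  refine ⟨hf.continuous, ?_⟩
  obtain ⟨g, hg, hgk⟩ := hf.exists_coeff_eq_prod_mul Finset.univ
  -- The product weight `P` is gained twice: one factor dominates `1 + |k|^2`, and the other leaves
  -- the summable `1/P`.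
  obtain ⟨g', hg', hgk'⟩ := hg.exists_coeff_eq_prod_mul Finset.univ
  have hs := summable_pi_prod (ι := Fin d) (g := fun _ (n : ℤ) => 1 / (1 + (n : ℝ) ^ 2))
    (fun _ n => by positivity) fun _ => summable_one_div_one_add_sq
  refine Summable.of_nonneg_of_le (fun k => by positivity) (fun k => ?_)
    (hs.mul_right (∫ x, |g' x| ∂torusMeasure d))
  have h1 := norm_coeff_le g' k
  set P := ∏ i, (1 + (k i : ℝ) ^ 2) with hP
  have hP0 : 0 < P := Finset.prod_pos fun i _ => by positivity
  have hP1 : 1 + freqNorm k ^ 2 ≤ P := by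
    rw [freqNorm_sq]
    exact one_add_sum_le_prod_one_add _ fun i => sq_nonneg _
  rw [hgk', hgk, norm_mul, norm_mul, Complex.norm_real, Real.norm_eq_abs, abs_of_pos hP0] at h1
  rw [Finset.prod_div_distrib, Finset.prod_const_one, ← hP, one_div, le_inv_mul_iff₀ hP0]
  refine h1.trans' ?_
  gcongr

/-! ### The fractional semigroup and decay of the `p`-th moment -/

theorem exp_neg_mul_freqNorm_le_one {s t : ℝ} (ht : 0 ≤ t) (k : Fin d → ℤ) :
    Real.exp (-t * freqNorm k ^ s) ≤ 1 := by
  rw [Real.exp_le_one_iff]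
  have := Real.rpow_nonneg (freqNorm_nonneg k) s
  nlinarith

namespace HasSummableLaplacian

variable {f : UnitAddTorus (Fin d) → ℝ}

theorem summable_norm_coeff (hf : HasSummableLaplacian f) : Summable fun k => ‖coeff f k‖ :=
  Summable.of_nonneg_of_le (fun k => norm_nonneg _)
    (fun k => le_mul_of_one_le_left (norm_nonneg _) (by linarith [sq_nonneg (freqNorm k)]))
    hf.summable

theorem summable_fracHeat (hf : HasSummableLaplacian f) {s t : ℝ} (ht : 0 ≤ t) :
    Summable fun k => |Real.exp (-t * freqNorm k ^ s)| * ‖coeff f k‖ :=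
  hf.summable_mul fun k => by
    rw [Real.abs_exp]
    linarith [exp_neg_mul_freqNorm_le_one (s := s) ht k, sq_nonneg (freqNorm k)]

theorem coeff_fracHeat (hf : HasSummableLaplacian f) {s t : ℝ} (ht : 0 ≤ t) (k : Fin d → ℤ) :
    coeff (fracHeat s t f) k = (Real.exp (-t * freqNorm k ^ s) : ℂ) * coeff f k :=
  coeff_fourierMultiplier (fun k => by rw [freqNorm_neg]) (hf.summable_fracHeat ht) k

theorem norm_coeff_fracHeat_le (hf : HasSummableLaplacian f) {s t : ℝ} (ht : 0 ≤ t)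
    (k : Fin d → ℤ) : ‖coeff (fracHeat s t f) k‖ ≤ ‖coeff f k‖ := by
  rw [hf.coeff_fracHeat ht, norm_mul, Complex.norm_real, Real.norm_eq_abs, Real.abs_exp]
  exact mul_le_of_le_one_left (norm_nonneg _) (exp_neg_mul_freqNorm_le_one ht k)

/-- Stability of the class under the flow allows the Poincaré-type inequality to be applied at each
later time. -/
theorem fracHeat (hf : HasSummableLaplacian f) {s t : ℝ} (ht : 0 ≤ t) :
    HasSummableLaplacian (fracHeat s t f) where
  continuous := continuous_fourierMultiplier (hf.summable_fracHeat ht)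
  summable := Summable.of_nonneg_of_le (fun k => by positivity)
    (fun k => mul_le_mul_of_nonneg_left (hf.norm_coeff_fracHeat_le ht k) (by positivity))
    hf.summable

theorem integral_fracHeat (hf : HasSummableLaplacian f) {s t : ℝ} (ht : 0 ≤ t)
    (hmean : ∫ x, f x ∂torusMeasure d = 0) :
    ∫ x, TorusBernstein.fracHeat s t f x ∂torusMeasure d = 0 := by
  have h := hf.coeff_fracHeat (s := s) ht 0
  rw [coeff_zero, coeff_zero, hmean, Complex.ofReal_zero, mul_zero] at h
  exact_mod_cast h

theorem fracHeat_zero (hf : HasSummableLaplacian f) (s : ℝ) :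
    TorusBernstein.fracHeat s 0 f = f := by
  funext x
  rw [← fourierMultiplier_one hf x, TorusBernstein.fracHeat]
  simp

theorem abs_fracHeat_le (hf : HasSummableLaplacian f) {s t : ℝ} (ht : 0 ≤ t)
    (x : UnitAddTorus (Fin d)) :
    |TorusBernstein.fracHeat s t f x| ≤ ∑' k, ‖coeff f k‖ :=
  (abs_fourierMultiplier_le (hf.summable_fracHeat ht) x).trans
    ((hf.summable_fracHeat ht).tsum_le_tsum (fun k => by
      rw [Real.abs_exp]
      exact mul_le_of_le_one_left (norm_nonneg _) (exp_neg_mul_freqNorm_le_one ht k))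
      hf.summable_norm_coeff)

theorem summable_fracLaplacian (hf : HasSummableLaplacian f) {s : ℝ} (hs0 : 0 < s) (hs2 : s ≤ 2) :
    Summable fun k => |freqNorm k ^ s| * ‖coeff f k‖ :=
  hf.summable_mul fun k => by
    rw [abs_of_nonneg (Real.rpow_nonneg (freqNorm_nonneg k) s)]
    exact freqNorm_rpow_le hs0 hs2 k

theorem abs_fracLaplacian_fracHeat_le (hf : HasSummableLaplacian f) {s t : ℝ} (hs0 : 0 < s)
    (hs2 : s ≤ 2) (ht : 0 ≤ t) (x : UnitAddTorus (Fin d)) :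
    |fracLaplacian s (TorusBernstein.fracHeat s t f) x|
      ≤ ∑' k, |freqNorm k ^ s| * ‖coeff f k‖ :=
  (abs_fourierMultiplier_le ((hf.fracHeat ht).summable_fracLaplacian hs0 hs2) x).trans
    (((hf.fracHeat ht).summable_fracLaplacian hs0 hs2).tsum_le_tsum (fun k =>
      mul_le_mul_of_nonneg_left (hf.norm_coeff_fracHeat_le ht k) (abs_nonneg _))
      (hf.summable_fracLaplacian hs0 hs2))

theorem hasDerivAt_fracHeat (hf : HasSummableLaplacian f) {s t : ℝ} (hs0 : 0 < s) (hs2 : s ≤ 2)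
    (ht : 0 < t) (x : UnitAddTorus (Fin d)) :
    HasDerivAt (fun t => TorusBernstein.fracHeat s t f x)
      (-fracLaplacian s (TorusBernstein.fracHeat s t f) x) t := by
  have h := hasDerivAt_tsum_of_isPreconnected (𝕜 := ℝ) (t := Set.Ioi (0 : ℝ)) (y₀ := t) (y := t)
    (g := fun (k : Fin d → ℤ) (t : ℝ) =>
      (Real.exp (-t * freqNorm k ^ s) : ℂ) * coeff f k * UnitAddTorus.mFourier k x)
    (g' := fun (k : Fin d → ℤ) (t : ℝ) =>
      ((Real.exp (-t * freqNorm k ^ s) * (-freqNorm k ^ s) : ℝ) : ℂ) * coeff f k *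
        UnitAddTorus.mFourier k x)
    (hf.summable_fracLaplacian hs0 hs2) isOpen_Ioi isPreconnected_Ioi
    (fun k r _ => by
      have : HasDerivAt (fun r : ℝ => Real.exp (-r * freqNorm k ^ s))
          (Real.exp (-r * freqNorm k ^ s) * (-freqNorm k ^ s)) r := by
        simpa using (((hasDerivAt_id r).neg.mul_const (freqNorm k ^ s)).exp)
      exact (this.ofReal_comp.mul_const _).mul_const _)
    (fun k r hr => by
      have hr' : (0 : ℝ) ≤ r := le_of_lt hr
      rw [norm_mul, norm_mul, norm_mFourier_apply, mul_one, Complex.norm_real, Real.norm_eq_abs,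
        abs_mul, abs_neg, Real.abs_exp]
      gcongr
      exact mul_le_of_le_one_left (abs_nonneg _) (exp_neg_mul_freqNorm_le_one hr' k))
    ht (Summable.of_norm_bounded (hf.summable_fracHeat (s := s) ht.le) fun k =>
      (norm_multiplierSeries_term (fun k => Real.exp (-t * freqNorm k ^ s)) f x k).le) ht
  have h2 : HasDerivAt (fun t => TorusBernstein.fracHeat s t f x) _ t :=
    Complex.reCLM.hasFDerivAt.comp_hasDerivAt t h
  convert! h2 using 1
  rw [fracLaplacian, fourierMultiplier, multiplierSeries, ← Complex.neg_re, ← tsum_neg,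
    Complex.reCLM_apply]
  congr 1
  refine tsum_congr fun k => ?_
  rw [show UnitAddTorus.mFourierCoeff (fun y => (TorusBernstein.fracHeat s t f y : ℂ)) k = _ from
    hf.coeff_fracHeat ht.le k]
  push_cast
  ring

theorem continuousOn_fracHeat (hf : HasSummableLaplacian f) {s : ℝ} (x : UnitAddTorus (Fin d)) :
    ContinuousOn (fun t => TorusBernstein.fracHeat s t f x) (Set.Ici 0) :=
  Complex.continuous_re.comp_continuousOn (continuousOn_tsum (fun k => by fun_prop)
    hf.summable_norm_coeff fun k t ht => by
      refine (norm_multiplierSeries_term (fun k => Real.exp (-t * freqNorm k ^ s)) f x k).trans_le ?_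
      rw [Real.abs_exp]
      exact mul_le_of_le_one_left (norm_nonneg _) (exp_neg_mul_freqNorm_le_one ht k))

/-- Supplies continuity up to `t = 0`, while the derivative is computed only for `t > 0`. -/
theorem continuousOn_integral_abs_fracHeat_rpow (hf : HasSummableLaplacian f) {s p : ℝ}
    (hp : 0 < p) :
    ContinuousOn (fun t => ∫ x, |TorusBernstein.fracHeat s t f x| ^ p ∂torusMeasure d)
      (Set.Ici 0) := by
  refine continuousOn_of_dominated (bound := fun _ => (∑' k, ‖coeff f k‖) ^ p) (fun t ht => ?_)
    (fun t ht => Eventually.of_forall fun x => ?_) (integrable_const _)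
    (Eventually.of_forall fun x => ?_)
  · exact (integrable_torus ((hf.fracHeat ht).continuous.abs.rpow_const
      fun _ => Or.inr hp.le)).aestronglyMeasurable
  · rw [Real.norm_eq_abs, abs_of_nonneg (by positivity)]
    gcongr
    exact hf.abs_fracHeat_le ht x
  · exact (hf.continuousOn_fracHeat x).abs.rpow_const fun _ _ => Or.inr hp.le

theorem hasDerivAt_integral_abs_fracHeat_rpow (hf : HasSummableLaplacian f) {s p t : ℝ}
    (hs0 : 0 < s) (hs2 : s ≤ 2) (hp : 1 < p) (ht : 0 < t) :
    HasDerivAt (fun t => ∫ x, |TorusBernstein.fracHeat s t f x| ^ p ∂torusMeasure d)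
      (-(p * ∫ x, fracLaplacian s (TorusBernstein.fracHeat s t f) x *
        |TorusBernstein.fracHeat s t f x| ^ (p - 2) * TorusBernstein.fracHeat s t f x
        ∂torusMeasure d)) t := by
  -- For `p < 2` the factor `|y|^{p-2}` is singular at `0`; grouping it with `y` into a signed power
  -- of exponent `p - 1 > 0` gives continuity and a uniform bound.
  have hform : ∀ r x, p * |TorusBernstein.fracHeat s r f x| ^ (p - 2) *
      TorusBernstein.fracHeat s r f x * -fracLaplacian s (TorusBernstein.fracHeat s r f) x
      = p * signedPow (p - 1) (TorusBernstein.fracHeat s r f x) *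
        -fracLaplacian s (TorusBernstein.fracHeat s r f) x := fun r x => by
    rw [signedPow, show p - 1 - 1 = p - 2 by ring]
    ring
  have h := (hasDerivAt_integral_of_dominated_loc_of_deriv_le (μ := torusMeasure d)
    (s := Set.Ioi 0) (x₀ := t) (F := fun t x => |TorusBernstein.fracHeat s t f x| ^ p)
    (F' := fun t x => p * |TorusBernstein.fracHeat s t f x| ^ (p - 2) *
      TorusBernstein.fracHeat s t f x * -fracLaplacian s (TorusBernstein.fracHeat s t f) x)
    (bound := fun _ => p * (∑' k, ‖coeff f k‖) ^ (p - 1) *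
      ∑' k, |freqNorm k ^ s| * ‖coeff f k‖) (Ioi_mem_nhds ht)
    (by
      filter_upwards [Ioi_mem_nhds ht] with r hr
      exact (integrable_torus ((hf.fracHeat (le_of_lt hr)).continuous.abs.rpow_const
        fun _ => Or.inr (by linarith))).aestronglyMeasurable)
    (integrable_torus ((hf.fracHeat ht.le).continuous.abs.rpow_const fun _ => Or.inr (by linarith)))
    (by
      simp only [hform]
      have h1 := (continuous_signedPow (by linarith : 0 < p - 1)).comp
        (hf.fracHeat (s := s) ht.le).continuous
      have h2 : Continuous (fracLaplacian s (TorusBernstein.fracHeat s t f)) :=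
        continuous_fourierMultiplier ((hf.fracHeat ht.le).summable_fracLaplacian hs0 hs2)
      exact (integrable_torus ((continuous_const.mul h1).mul h2.neg)).aestronglyMeasurable)
    (Eventually.of_forall fun x r hr => by
      have hr' : (0 : ℝ) ≤ r := le_of_lt hr
      have hA := hf.abs_fracHeat_le (s := s) hr' x
      have hL := hf.abs_fracLaplacian_fracHeat_le hs0 hs2 hr' x
      rw [hform, norm_mul, norm_mul, norm_neg, Real.norm_eq_abs, Real.norm_eq_abs, Real.norm_eq_abs,
        abs_signedPow (by linarith), abs_of_pos (by linarith : 0 < p)]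
      have : 0 ≤ p - 1 := by linarith
      gcongr) (integrable_const _)
    (Eventually.of_forall fun x r hr =>
      (hasDerivAt_abs_rpow _ hp).comp r (hf.hasDerivAt_fracHeat hs0 hs2 hr x))).2
  convert! h using 1
  rw [← integral_const_mul, ← integral_neg]
  refine integral_congr_ae (Eventually.of_forall fun x => ?_)
  simp only
  ring

theorem integral_abs_fracHeat_rpow_le (hf : HasSummableLaplacian f) {s p t : ℝ}
    (hs0 : 0 < s) (hs2 : s ≤ 2) (hp : 1 < p) (ht : 0 ≤ t)
    (hmean : ∫ x, f x ∂torusMeasure d = 0) :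
    ∫ x, |TorusBernstein.fracHeat s t f x| ^ p ∂torusMeasure d
      ≤ Real.exp (-(p * (powConst (2 / p) / 2) * t)) * ∫ x, |f x| ^ p ∂torusMeasure d := by
  set c := powConst (2 / p) / 2
  set G : ℝ → ℝ := fun t => ∫ x, |TorusBernstein.fracHeat s t f x| ^ p ∂torusMeasure d with hG
  have hderiv : ∀ r, 0 < r → HasDerivAt (fun t => Real.exp (p * c * t) * G t) _ r := fun r hr =>
    (((hasDerivAt_id r).const_mul (p * c)).exp).mul
      (hf.hasDerivAt_integral_abs_fracHeat_rpow hs0 hs2 hp hr)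
  -- Grönwall's argument: the Poincaré-type inequality says `G' ≤ -p c G`.
  have hanti : AntitoneOn (fun t => Real.exp (p * c * t) * G t) (Set.Ici 0) := by
    refine antitoneOn_of_deriv_nonpos (convex_Ici 0) ?_ ?_ ?_
    · exact (by fun_prop : Continuous fun t : ℝ => Real.exp (p * c * t)).continuousOn.mul
        (hf.continuousOn_integral_abs_fracHeat_rpow (by linarith))
    · rw [interior_Ici]
      exact fun r hr => (hderiv r hr).differentiableAt.differentiableWithinAt
    · rw [interior_Ici]
      intro r hr
      have hr' : (0 : ℝ) < r := hr
      rw [(hderiv r hr').deriv]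
      have h1 := (hf.fracHeat (s := s) hr'.le).le_integral_fracLaplacian
        (hf.integral_fracHeat (s := s) hr'.le hmean) hs0 hs2 hp
      have h2 : p * (c * G r) ≤ p * ∫ x, fracLaplacian s (TorusBernstein.fracHeat s r f) x *
          |TorusBernstein.fracHeat s r f x| ^ (p - 2) * TorusBernstein.fracHeat s r f x
          ∂torusMeasure d := mul_le_mul_of_nonneg_left h1 (by linarith)
      have h3 := Real.exp_pos (p * c * r)
      simp only [id, mul_one]
      change Real.exp (p * c * r) * (p * c) * G r + _ ≤ 0
      nlinarith
  have h := hanti (Set.mem_Ici.2 le_rfl) (Set.mem_Ici.2 ht) ht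
  simp only [mul_zero, Real.exp_zero, one_mul] at h
  have h0 : G 0 = ∫ x, |f x| ^ p ∂torusMeasure d := by
    rw [hG]
    simp only [hf.fracHeat_zero]
  rw [h0] at h
  rw [Real.exp_neg, le_inv_mul_iff₀ (Real.exp_pos _)]
  exact h

end HasSummableLaplacian

/-! ### From moments to `L^p` norms -/

theorem eLpNorm_eq_ofReal_integral {f : UnitAddTorus (Fin d) → ℝ} (hf : Continuous f) {p : ℝ}
    (hp : 0 < p) : eLpNorm f (ENNReal.ofReal p) (torusMeasure d)
      = ENNReal.ofReal ((∫ x, |f x| ^ p ∂torusMeasure d) ^ p⁻¹) := by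
  have hmem : MemLp f (ENNReal.ofReal p) (torusMeasure d) :=
    hf.memLp_of_hasCompactSupport (HasCompactSupport.of_compactSpace f)
  rw [hmem.eLpNorm_eq_integral_rpow_norm (by simpa using hp) ENNReal.ofReal_ne_top,
    ENNReal.toReal_ofReal hp.le]
  simp only [Real.norm_eq_abs]

theorem HasSummableLaplacian.eLpNorm_fracHeat_le {f : UnitAddTorus (Fin d) → ℝ}
    (hf : HasSummableLaplacian f) {s p t : ℝ}
    (hs0 : 0 < s) (hs2 : s ≤ 2) (hp : 1 < p) (ht : 0 ≤ t)
    (hmean : ∫ x, f x ∂torusMeasure d = 0) :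
    eLpNorm (TorusBernstein.fracHeat s t f) (ENNReal.ofReal p) (torusMeasure d)
      ≤ ENNReal.ofReal (Real.exp (-(powConst (2 / p) / 2) * t)) *
        eLpNorm f (ENNReal.ofReal p) (torusMeasure d) := by
  have hp0 : 0 < p := by linarith
  rw [eLpNorm_eq_ofReal_integral (hf.fracHeat ht).continuous hp0,
    eLpNorm_eq_ofReal_integral hf.continuous hp0, ← ENNReal.ofReal_mul (Real.exp_pos _).le]
  refine ENNReal.ofReal_le_ofReal ?_
  have hE : 0 ≤ ∫ x, |f x| ^ p ∂torusMeasure d := integral_nonneg fun x => by positivity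
  have hE' : 0 ≤ ∫ x, |TorusBernstein.fracHeat s t f x| ^ p ∂torusMeasure d :=
    integral_nonneg fun x => by positivity
  refine (Real.rpow_le_rpow hE' (hf.integral_abs_fracHeat_rpow_le hs0 hs2 hp ht hmean)
    (by positivity)).trans_eq ?_
  -- The `p`-th root turns the rate `p c` of the moment into the rate `c` of the norm.
  rw [Real.mul_rpow (Real.exp_pos _).le hE, ← Real.exp_mul]
  congr 2
  field_simp

end TorusBernstein

theorem theorem4p1 (d : ℕ) (hd : 1 ≤ d) (s : ℝ) (hs0 : 0 < s) (hs2 : s ≤ 2)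
    (p : ℝ) (hp : 1 < p) :
    (∃ c : ℝ, 0 < c ∧ ∀ f : UnitAddTorus (Fin d) → ℝ, TorusBernstein.TorusSmooth f →
      ∫ x, f x ∂(TorusBernstein.torusMeasure d) = 0 →
      ∀ t : ℝ, 0 < t →
        MeasureTheory.eLpNorm (TorusBernstein.fracHeat s t f) (ENNReal.ofReal p)
            (TorusBernstein.torusMeasure d)
          ≤ ENNReal.ofReal (Real.exp (-c * t)) *
            MeasureTheory.eLpNorm f (ENNReal.ofReal p) (TorusBernstein.torusMeasure d)) ∧
    (∃ c' : ℝ, 0 < c' ∧ ∀ f : UnitAddTorus (Fin d) → ℝ, TorusBernstein.TorusSmooth f →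
      ∫ x, f x ∂(TorusBernstein.torusMeasure d) = 0 →
        c' * ∫ x, |f x| ^ p ∂(TorusBernstein.torusMeasure d)
          ≤ ∫ x, TorusBernstein.fracLaplacian s f x * |f x| ^ (p - 2) * f x
              ∂(TorusBernstein.torusMeasure d)) := by
  have hc : 0 < TorusBernstein.powConst (2 / p) / 2 := by
    have hp0 : 0 < p := by linarith
    have := TorusBernstein.powConst_pos (r := 2 / p) (by positivity) (by
      rw [div_lt_iff₀ hp0]
      linarith)
    positivity
  exact ⟨⟨_, hc, fun f hf hmean t ht =>
      hf.hasSummableLaplacian.eLpNorm_fracHeat_le hs0 hs2 hp ht.le hmean⟩,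
    ⟨_, hc, fun f hf hmean =>
      hf.hasSummableLaplacian.le_integral_fracLaplacian hmean hs0 hs2 hp⟩⟩
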